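/- \textbf{The Chow--Robbins game.} A fair coin is flipped repeatedly and the player, who sees the outcomes, may stop at any time; the payoff is the proportion of heads at that time. For integers $0\le a\le n$ let $V(a,n)$ be the expected payoff under optimal play from the position of $a$ heads in $n$ flips, that is, $$V(a,n)=\sup_{\tau}\ \mathbb E\left[\frac{a+S_\tau}{n+\tau}\right],$$ where $S_k$ is the number of heads among the next $k$ flips, and $\tau\in\{0,1,2,\dots\}$ runs over all almost surely finite stopping times of the sequence of these flips (with $0/0$ read as $0$). Stopping is optimal in position $(a,n)$ if $V(a,n)=a/n$, and continuing is better than stopping if $V(a,n)>a/n$. Write $h$--$t$ for the position with $h$ heads and $t$ tails, i.e. $(a,n)=(h,h+t)$; its difference is $h-t=2a-n$. \textbf{Theorem.} \begin{enumerate} \item $V(5,8)=5/8$; that is, stopping is optimal with 5 heads and 3 tails. \item If the difference is at most $0$, continuing is better than stopping. If the difference is at least $27$ and $n\le 1000$, stopping is optimal. For each difference from $1$ to $26$, stopping is optimal in every position with that difference up to and including the one in the column ``stop'', and continuing is better than stopping in every position with that difference from the one in the column ``go'' on: $$\begin{array}{ccc|ccc} \text{difference}&\text{stop}&\text{go}&\text{difference}&\text{stop}&\text{go}\\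 \hline 1&1\text{--}0&2\text{--}1&14&155\text{--}141&156\text{--}142\\ 2&5\text{--}3&6\text{--}4&15&176\text{--}161&177\text{--}162\\ 3&9\text{--}6&10\text{--}7&16&199\text{--}183&201\text{--}185\\ 4&16\text{--}12&17\text{--}13&17&224\text{--}207&225\text{--}208\\ 5&23\text{--}18&24\text{--}19&18&250\text{--}232&251\text{--}233\\ 6&32\text{--}26&33\text{--}27&19&277\text{--}258&279\text{--}260\\ 7&42\text{--}35&43\text{--}36&20&306\text{--}286&307\text{--}287\\ 8&54\text{--}46&55\text{--}47&21&336\text{--}315&338\text{--}317\\ 9&67\text{--}58&68\text{--}59&22&368\text{--}346&369\text{--}347\\ 10&82\text{--}72&83\text{--}73&23&401\text{--}378&402\text{--}379\\ 11&98\text{--}87&99\text{--}88&24&435\text{--}411&437\text{--}413\\ 12&115\text{--}103&117\text{--}105&25&471\text{--}446&473\text{--}448\\ 13&134\text{--}121&135\text{--}122&26&508\text{--}482&510\text{--}484 \end{array}$$ \item Among the positions with at most $1000$ flips, the ones for which (2) gives no decision are exactly the seven positions 116--104, 200--184, 278--259, 337--316, 436--412, 472--447 and 509--483. \end{enumerate}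 -/

import Mathlib

open MeasureTheory ProbabilityTheory

namespace ChowRobbins

/-- A sequence of future coin flips; `true` is heads, and `ω i` is flip number `i + 1` counted
from the current position. -/
abbrev Flips : Type := ℕ → Bool

/-- The law of infinitely many independent tosses of a fair coin. -/
noncomputable def coinMeasure : Measure Flips :=
  Measure.infinitePi fun _ : ℕ => (PMF.uniformOfFintype Bool).toMeasure

/-- The information available after `k` further flips: the outcomes of these `k` flips. -/
def flipFiltration : Filtration ℕ (MeasurableSpace.pi : MeasurableSpace Flips) where
  seq k := MeasurableSpace.comap (fun (ω : Flips) (i : Fin k) => ω i) MeasurableSpace.pi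
  mono' := by
    intro j k hjk
    have h : (fun (ω : Flips) (i : Fin j) => ω i) =
        (fun (v : Fin k → Bool) (i : Fin j) => v (Fin.castLE hjk i)) ∘
          (fun (ω : Flips) (i : Fin k) => ω i) := rfl
    change MeasurableSpace.comap _ _ ≤ _
    rw [h, ← MeasurableSpace.comap_comp]
    exact MeasurableSpace.comap_mono
      (measurable_pi_lambda _ fun i => measurable_pi_apply _).comap_le
  le' k := (measurable_pi_lambda _ fun i => measurable_pi_apply _).comap_le

/-- The number of heads among the next `k` flips. -/
def heads (k : ℕ) (ω : Flips) : ℕ := ((Finset.range k).filter fun i => ω i = true).card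

/-- The proportion of heads after `k` further flips, starting from `a` heads in `n` flips.
Where no flip has been made at all (`n = k = 0`) this is `0`. -/
noncomputable def proportion (a n k : ℕ) (ω : Flips) : ℝ :=
  ((a : ℝ) + (heads k ω : ℝ)) / ((n : ℝ) + (k : ℝ))

/-- A strategy: a stopping time of the flips (the number of further flips before stopping) that
is finite with probability one. -/
def IsStrategy (τ : Flips → WithTop ℕ) : Prop :=
  IsStoppingTime flipFiltration τ ∧ ∀ᵐ ω ∂coinMeasure, τ ω ≠ ⊤

/-- The expected payoff of the strategy `τ` from the position `(a, n)`. -/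
noncomputable def expectedPayoff (a n : ℕ) (τ : Flips → WithTop ℕ) : ℝ :=
  ∫ ω, stoppedValue (proportion a n) τ ω ∂coinMeasure

/-- The expected payoff under optimal play from the position of `a` heads in `n` flips: the
supremum over all strategies (all these payoffs lie in `[0, 1]` when `a ≤ n`). -/
noncomputable def V (a n : ℕ) : ℝ :=
  sSup {r : ℝ | ∃ τ : Flips → WithTop ℕ, IsStrategy τ ∧ r = expectedPayoff a n τ}

/-- Stopping in the position `(a, n)` is optimal. -/
def StoppingOptimal (a n : ℕ) : Prop := V a n = (a : ℝ) / (n : ℝ)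

/-- In the position `(a, n)` continuing is better than stopping. -/
def ContinuingBetter (a n : ℕ) : Prop := (a : ℝ) / (n : ℝ) < V a n

/-- The rows of the table: a difference `d` (heads minus tails), the last position
`(heads, tails)` with that difference in which one stops, and a position `(heads, tails)` from
which on one goes on. -/
def openingTable : List (ℕ × (ℕ × ℕ) × (ℕ × ℕ)) :=
  [(1, (1, 0), (2, 1)),
   (2, (5, 3), (6, 4)),
   (3, (9, 6), (10, 7)),
   (4, (16, 12), (17, 13)),
   (5, (23, 18), (24, 19)),
   (6, (32, 26), (33, 27)),
   (7, (42, 35), (43, 36)),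
   (8, (54, 46), (55, 47)),
   (9, (67, 58), (68, 59)),
   (10, (82, 72), (83, 73)),
   (11, (98, 87), (99, 88)),
   (12, (115, 103), (117, 105)),
   (13, (134, 121), (135, 122)),
   (14, (155, 141), (156, 142)),
   (15, (176, 161), (177, 162)),
   (16, (199, 183), (201, 185)),
   (17, (224, 207), (225, 208)),
   (18, (250, 232), (251, 233)),
   (19, (277, 258), (279, 260)),
   (20, (306, 286), (307, 287)),
   (21, (336, 315), (338, 317)),
   (22, (368, 346), (369, 347)),
   (23, (401, 378), (402, 379)),
   (24, (435, 411), (437, 413)),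
   (25, (471, 446), (473, 448)),
   (26, (508, 482), (510, 484))]

/-- The table says to stop with `a` heads in `n` flips. -/
def TableStop (a n : ℕ) : Prop :=
  (27 ≤ 2 * (a : ℤ) - n ∧ n ≤ 1000) ∨
    ∃ d hs ts hg tg : ℕ, (d, (hs, ts), (hg, tg)) ∈ openingTable ∧
      2 * (a : ℤ) - n = d ∧ n ≤ hs + ts

/-- The table says to continue with `a` heads in `n` flips. -/
def TableGo (a n : ℕ) : Prop :=
  2 * (a : ℤ) - n ≤ 0 ∨
    ∃ d hs ts hg tg : ℕ, (d, (hs, ts), (hg, tg)) ∈ openingTable ∧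
      2 * (a : ℤ) - n = d ∧ hg + tg ≤ n

/-- The seven positions `(heads, tails)` that are left open. -/
def openPositions : List (ℕ × ℕ) :=
  [(116, 104), (200, 184), (278, 259), (337, 316), (436, 412), (472, 447), (509, 483)]

end ChowRobbins

namespace ChowRobbins

/-! Write W(x, n) (`diffValue`) for the value of the game with payoff x / n, where x is the
difference. Optional stopping applied to the finite-horizon Bellman recursion gives V = (1 + W) / 2
(`V_eq_diffValue`). W is Lipschitz in x with constant 1 / n (`diffValue_add_le`), so for each n the
differences at which stopping is optimal are upward closed, and only a threshold has to be located.

Far out, W is squeezed by the solution of the problem for Brownian motion. There each exp(l x - l² n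
/ 2) is a martingale, hence so is the integral G(x, n) over l > 0 (`gaussMoment 0`). The optimal
value is (1 - α²) G below the boundary x = α √n, where α ≈ 0.8399 makes (1 - α²) G tangent to the
payoff. For coin flips, cosh l ≤ exp(l² / 2) makes G superharmonic, and a constant c slightly above
1 - α² gives W ≤ c G (`diffValue_le_gaussMoment`). Conversely, exp(-l² / 2) cosh l ≥ 1 - l⁴ / 12
bounds the relative loss per flip by 1 / n². A factor 1 - 1.1 / n recovers this loss and also pays
for overshooting the boundary, which bounds W below for n ≥ 2500 (`lowerValue_le_diffValue`).

At n = 2500 the moment recurrences turn the single number G(42, 2500) into integer bounds for W at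
differences spaced by two. Bellman's equation carries these bounds and the threshold back to the
opening, in fixed point arithmetic with directed rounding. The kernel evaluates this and compares
with the table at each n (`runLower_seed`, `runUpper_start`); `runLower_sound` and `runUpper_sound`
say what the evaluation proves. -/

/-! ### The Bellman recursion for the payoff difference / flips. -/

/-- The value of the game with at most `k` further flips, for the payoff
(heads minus tails) / flips, from difference `x` after `n` flips. -/
noncomputable def horizonValue : ℕ → ℤ → ℕ → ℝ
  | 0, x, n => (x : ℝ) / n
  | k + 1, x, n =>
    max ((x : ℝ) / n) ((horizonValue k (x + 1) (n + 1) + horizonValue k (x - 1) (n + 1)) / 2)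

theorem div_le_horizonValue (k : ℕ) (x : ℤ) (n : ℕ) : (x : ℝ) / n ≤ horizonValue k x n := by
  cases k with
  | zero => exact le_rfl
  | succ k => exact le_max_left _ _

theorem horizonValue_le_succ (k : ℕ) (x : ℤ) (n : ℕ) :
    horizonValue k x n ≤ horizonValue (k + 1) x n := by
  induction k generalizing x n with
  | zero => exact le_max_left _ _
  | succ k ih =>
    simp only [horizonValue] at ih ⊢
    exact max_le_max le_rfl (by linarith [ih (x + 1) (n + 1), ih (x - 1) (n + 1)])

theorem horizonValue_monotone (x : ℤ) (n : ℕ) : Monotone fun k => horizonValue k x n :=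
  monotone_nat_of_le_succ fun k => horizonValue_le_succ k x n

/-- A superharmonic majorant of the payoff bounds the value. -/
theorem horizonValue_le_of_superharmonic {F : ℤ → ℕ → ℝ}
    (hF : ∀ (x : ℤ) (n : ℕ), 1 ≤ n → (x : ℝ) / n ≤ F x n)
    (hF' : ∀ (x : ℤ) (n : ℕ), 1 ≤ n → (F (x + 1) (n + 1) + F (x - 1) (n + 1)) / 2 ≤ F x n)
    (k : ℕ) (x : ℤ) {n : ℕ} (hn : 1 ≤ n) : horizonValue k x n ≤ F x n := by
  induction k generalizing x n with
  | zero => exact hF x n hn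
  | succ k ih =>
    have := hF' x n hn
    exact max_le (hF x n hn)
      (by linarith [ih (x + 1) (n := n + 1) (by omega), ih (x - 1) (n := n + 1) (by omega)])

/-- The difference is an arbitrary integer, so `x / n` may exceed `1`. The majorant is superharmonic
because `(x + 1) / (n + 1)` lies between `x / n` and `1`. -/
theorem horizonValue_le_max (k : ℕ) (x : ℤ) {n : ℕ} (hn : 1 ≤ n) :
    horizonValue k x n ≤ max ((x : ℝ) / n) 1 := by
  refine horizonValue_le_of_superharmonic (F := fun x n => max ((x : ℝ) / n) 1)
    (fun x n _ => le_max_left _ _) (fun x n hn => ?_) k x hn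
  have hn0 : (0 : ℝ) < n := by exact_mod_cast hn
  have key : ∀ y : ℝ, y ≤ x + 1 → max (y / (n + 1 : ℝ)) 1 ≤ max ((x : ℝ) / n) 1 := by
    intro y hy
    refine max_le ?_ (le_max_right _ _)
    rcases le_total (x : ℝ) n with h | h
    · refine le_trans ?_ (le_max_right _ _)
      rw [div_le_one (by positivity)]; linarith
    · refine le_trans ?_ (le_max_left _ _)
      rw [div_le_div_iff₀ (by positivity) hn0]
      nlinarith
  have h1 := key (x + 1) le_rfl
  have h2 := key (x - 1) (by linarith)
  push_cast
  linarith

/-- Under the same strategy the two games always differ by `y - x`, so their payoffs differ by this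
over the final number of flips, which is at least `n`. -/
theorem horizonValue_add_le (k : ℕ) {x y : ℤ} (hxy : x ≤ y) {n : ℕ} (hn : 1 ≤ n) :
    horizonValue k y n ≤ horizonValue k x n + ((y : ℝ) - x) / n := by
  have hn0 : (0 : ℝ) < n := by exact_mod_cast hn
  have hxy' : (x : ℝ) ≤ y := by exact_mod_cast hxy
  induction k generalizing x y n with
  | zero => simp only [horizonValue]; rw [← add_div]; apply le_of_eq; ring
  | succ k ih =>
    have h1 := ih (x := x + 1) (y := y + 1) (by omega) (n := n + 1) (by omega) (by positivity)
      (by push_cast; linarith)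
    have h2 := ih (x := x - 1) (y := y - 1) (by omega) (n := n + 1) (by omega) (by positivity)
      (by push_cast; linarith)
    simp only [horizonValue]
    push_cast at h1 h2
    have h3 : ((y : ℝ) - x) / (n + 1) ≤ (y - x) / n := by
      apply div_le_div_of_nonneg_left (by linarith) hn0 (by linarith)
    have e1 : ((y : ℝ) + 1 - (x + 1)) = y - x := by ring
    have e2 : ((y : ℝ) - 1 - (x - 1)) = y - x := by ring
    rw [e1] at h1
    rw [e2] at h2
    apply max_le
    · have : (y : ℝ) / n = x / n + (y - x) / n := by rw [← add_div]; congr 1; ring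
      rw [this]
      gcongr
      exact le_max_left _ _
    · refine le_trans ?_ (add_le_add_left (le_max_right _ _) _)
      linarith

theorem horizonValue_mono_left (k : ℕ) {x y : ℤ} (hxy : x ≤ y) (n : ℕ) :
    horizonValue k x n ≤ horizonValue k y n := by
  have hxy' : (x : ℝ) ≤ y := by exact_mod_cast hxy
  induction k generalizing x y n with
  | zero => simp only [horizonValue]; gcongr
  | succ k ih =>
    simp only [horizonValue]
    have h1 := ih (x := x + 1) (y := y + 1) (by omega) (n + 1) (by push_cast; linarith)
    have h2 := ih (x := x - 1) (y := y - 1) (by omega) (n + 1) (by push_cast; linarith)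
    apply max_le_max
    · gcongr
    · linarith

/-- The value of the game for the payoff (heads minus tails) / flips. -/
noncomputable def diffValue (x : ℤ) (n : ℕ) : ℝ := ⨆ k, horizonValue k x n

theorem bddAbove_horizonValue (x : ℤ) {n : ℕ} (hn : 1 ≤ n) :
    BddAbove (Set.range fun k => horizonValue k x n) :=
  ⟨max ((x : ℝ) / n) 1, by rintro _ ⟨k, rfl⟩; exact horizonValue_le_max k x hn⟩

theorem horizonValue_le_diffValue (k : ℕ) (x : ℤ) {n : ℕ} (hn : 1 ≤ n) :
    horizonValue k x n ≤ diffValue x n :=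
  le_ciSup (bddAbove_horizonValue x hn) k

theorem tendsto_horizonValue (x : ℤ) {n : ℕ} (hn : 1 ≤ n) :
    Filter.Tendsto (fun k => horizonValue k x n) Filter.atTop (nhds (diffValue x n)) :=
  tendsto_atTop_ciSup (horizonValue_monotone x n) (bddAbove_horizonValue x hn)

theorem div_le_diffValue (x : ℤ) {n : ℕ} (hn : 1 ≤ n) : (x : ℝ) / n ≤ diffValue x n :=
  horizonValue_le_diffValue 0 x hn

/-- Bellman's equation. -/
theorem diffValue_eq_max (x : ℤ) {n : ℕ} (hn : 1 ≤ n) :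
    diffValue x n =
      max ((x : ℝ) / n) ((diffValue (x + 1) (n + 1) + diffValue (x - 1) (n + 1)) / 2) := by
  have h1 := (Filter.tendsto_add_atTop_iff_nat 1).2 (tendsto_horizonValue x hn)
  refine tendsto_nhds_unique h1 ?_
  simp only [horizonValue]
  exact tendsto_const_nhds.max
    (((tendsto_horizonValue (x + 1) (n := n + 1) (by omega)).add
      (tendsto_horizonValue (x - 1) (n := n + 1) (by omega))).div_const 2)

theorem average_le_diffValue (x : ℤ) {n : ℕ} (hn : 1 ≤ n) :
    (diffValue (x + 1) (n + 1) + diffValue (x - 1) (n + 1)) / 2 ≤ diffValue x n := by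
  rw [diffValue_eq_max x hn]; exact le_max_right _ _

theorem diffValue_add_le {x y : ℤ} (hxy : x ≤ y) {n : ℕ} (hn : 1 ≤ n) :
    diffValue y n ≤ diffValue x n + ((y : ℝ) - x) / n :=
  ciSup_le fun k => (horizonValue_add_le k hxy hn).trans
    (by gcongr; exact horizonValue_le_diffValue k x hn)

theorem diffValue_mono_left {x y : ℤ} (hxy : x ≤ y) {n : ℕ} (hn : 1 ≤ n) :
    diffValue x n ≤ diffValue y n :=
  ciSup_le fun k => (horizonValue_mono_left k hxy n).trans (horizonValue_le_diffValue k y hn)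

/-- If stopping is optimal at some difference, then at every larger one. -/
theorem diffValue_eq_of_le {x y : ℤ} (hxy : x ≤ y) {n : ℕ} (hn : 1 ≤ n)
    (hx : diffValue x n ≤ (x : ℝ) / n) : diffValue y n ≤ (y : ℝ) / n := by
  have h := diffValue_add_le hxy hn
  have : (y : ℝ) / n = x / n + (y - x) / n := by rw [← add_div]; congr 1; ring
  linarith

/-- If continuing is better at some difference, then at every smaller one. -/
theorem div_lt_diffValue_of_le {x y : ℤ} (hxy : x ≤ y) {n : ℕ} (hn : 1 ≤ n)
    (hy : (y : ℝ) / n < diffValue y n) : (x : ℝ) / n < diffValue x n := by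
  by_contra h
  exact absurd (diffValue_eq_of_le hxy hn (not_lt.1 h)) (not_le.2 hy)

/-- A function dominated by the larger of the payoff and its own average is, up to a
supermartingale error, a lower bound for the value with horizon `K`. -/
theorem sub_le_horizonValue {L E : ℤ → ℕ → ℝ} {N K : ℕ}
    (hL : ∀ (x : ℤ) (n : ℕ), N ≤ n →
      L x n ≤ (x : ℝ) / n ∨ L x n ≤ (L (x + 1) (n + 1) + L (x - 1) (n + 1)) / 2)
    (hE0 : ∀ x n, n ≤ K → 0 ≤ E x n)
    (hE : ∀ x n, n < K → (E (x + 1) (n + 1) + E (x - 1) (n + 1)) / 2 ≤ E x n)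
    (hK : ∀ y : ℤ, L y K - E y K ≤ (y : ℝ) / K)
    (k : ℕ) (x : ℤ) {n : ℕ} (hn : N ≤ n) (hnK : n + k = K) :
    L x n - E x n ≤ horizonValue k x n := by
  induction k generalizing x n with
  | zero => rw [← hnK] at hK; exact hK x
  | succ k ih =>
    have h1 := ih (x + 1) (n := n + 1) (by omega) (by omega)
    have h2 := ih (x - 1) (n := n + 1) (by omega) (by omega)
    rcases hL x n hn with h | h
    · exact le_trans (by linarith [hE0 x n (by omega)]) (div_le_horizonValue _ _ _)
    · refine le_trans ?_ (le_max_right _ _)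
      linarith [hE x n (by omega)]

/-! ### Strategies on coin flips and optional stopping. -/

/-- The optimal expected proportion with at most `k` further flips. -/
noncomputable def horizonProportion : ℕ → ℕ → ℕ → ℝ
  | 0, a, n => (a : ℝ) / n
  | k + 1, a, n =>
    max ((a : ℝ) / n)
      ((horizonProportion k a (n + 1) + horizonProportion k (a + 1) (n + 1)) / 2)

theorem div_le_horizonProportion (k a n : ℕ) : (a : ℝ) / n ≤ horizonProportion k a n := by
  cases k with
  | zero => exact le_rfl
  | succ k => exact le_max_left _ _

theorem horizonProportion_eq (k a : ℕ) {n : ℕ} (hn : 1 ≤ n) :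
    horizonProportion k a n = (1 + horizonValue k (2 * a - n) n) / 2 := by
  have key : ∀ (a n : ℕ), 1 ≤ n → (a : ℝ) / n = (1 + ((2 * a - n : ℤ) : ℝ) / n) / 2 := by
    intro a n hn
    have hn0 : (n : ℝ) ≠ 0 := by positivity
    push_cast
    field_simp
    ring
  induction k generalizing a n with
  | zero => exact key a n hn
  | succ k ih =>
    simp only [horizonProportion, horizonValue]
    rw [ih a (by omega), ih (a + 1) (by omega), key a n hn]
    have e1 : (2 * (a + 1 : ℕ) - (n + 1 : ℕ) : ℤ) = 2 * a - n + 1 := by push_cast; ring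
    have e2 : (2 * (a : ℕ) - (n + 1 : ℕ) : ℤ) = 2 * a - n - 1 := by push_cast; ring
    rw [e1, e2]
    rw [max_def, max_def]
    split_ifs <;> linarith

/-- The map reversing the outcome of flip `m + 1`. -/
def toggle (m : ℕ) (ω : Flips) : Flips := fun i => if i = m then !ω i else ω i

instance : IsProbabilityMeasure coinMeasure := by unfold coinMeasure; infer_instance

theorem measurePreserving_toggle (m : ℕ) :
    MeasurePreserving (toggle m) coinMeasure coinMeasure := by
  have hmeas : ∀ i, Measurable (fun b : Bool => if i = m then !b else b) :=
    fun i => measurable_of_finite _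
  refine ⟨measurable_pi_lambda _ fun i => (hmeas i).comp (measurable_pi_apply i), ?_⟩
  have hnot : ((PMF.uniformOfFintype Bool).toMeasure).map (fun b => !b) =
      (PMF.uniformOfFintype Bool).toMeasure := by
    rw [PMF.toMeasure_map (hf := measurable_of_finite _)]
    congr 1
    ext b
    simp [PMF.map_apply]
    cases b <;> simp
  have h := Measure.infinitePi_map_pi
    (μ := fun _ : ℕ => (PMF.uniformOfFintype Bool).toMeasure)
    (f := fun i (b : Bool) => if i = m then !b else b) hmeas
  unfold coinMeasure
  refine Eq.trans h ?_
  congr 1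
  funext i
  by_cases hi : i = m
  · simp only [hi, if_true]; exact hnot
  · simp [hi]

theorem heads_zero (ω : Flips) : heads 0 ω = 0 := by simp [heads]

theorem heads_succ (m : ℕ) (ω : Flips) :
    heads (m + 1) ω = heads m ω + if ω m = true then 1 else 0 := by
  unfold heads
  rw [Finset.range_add_one, Finset.filter_insert]
  split_ifs with h
  · rw [Finset.card_insert_of_notMem (by simp)]
  · simp

theorem heads_le (m : ℕ) (ω : Flips) : heads m ω ≤ m := by
  simpa [heads] using Finset.card_filter_le (Finset.range m) fun i => ω i = true

theorem heads_congr {m : ℕ} {ω ω' : Flips} (h : ∀ i < m, ω i = ω' i) : heads m ω = heads m ω' := by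
  unfold heads
  congr 1
  apply Finset.filter_congr
  intro i hi
  rw [h i (Finset.mem_range.1 hi)]

theorem toggle_apply_of_lt {i m : ℕ} (h : i < m) (ω : Flips) : toggle m ω i = ω i := by
  simp [toggle, h.ne]

theorem heads_toggle (m : ℕ) (ω : Flips) : heads m (toggle m ω) = heads m ω :=
  heads_congr fun _ hi => toggle_apply_of_lt hi ω

theorem measurable_heads (m : ℕ) : Measurable[flipFiltration m] (heads m) := by
  have h : heads m = (fun v : Fin m → Bool =>
      heads m (fun i => if hi : i < m then v ⟨i, hi⟩ else false)) ∘
        (fun (ω : Flips) (i : Fin m) => ω i) := by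
    funext ω
    exact heads_congr fun i hi => by simp [hi]
  rw [h]
  exact (measurable_of_finite _).comp (comap_measurable _)

theorem toggle_mem_iff {m : ℕ} {A : Set Flips} (hA : MeasurableSet[flipFiltration m] A)
    (ω : Flips) : toggle m ω ∈ A ↔ ω ∈ A := by
  obtain ⟨B, -, rfl⟩ := hA
  have : (fun i : Fin m => toggle m ω i) = fun i : Fin m => ω i :=
    funext fun i => toggle_apply_of_lt i.2 ω
  simp only [Set.mem_preimage, this]

theorem integrable_comp_heads (m : ℕ) (g : ℕ → ℝ) :
    Integrable (fun ω => g (heads m ω)) coinMeasure := by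
  have hm : Measurable fun ω : Flips => g (heads m ω) :=
    (measurable_of_countable g).comp ((measurable_heads m).mono (flipFiltration.le m) le_rfl)
  refine Integrable.of_bound hm.aestronglyMeasurable (∑ i ∈ Finset.range (m + 1), ‖g i‖)
    (Filter.Eventually.of_forall fun ω => ?_)
  exact Finset.single_le_sum (f := fun i => ‖g i‖) (fun _ _ => norm_nonneg _)
    (Finset.mem_range.2 (Nat.lt_succ_of_le (heads_le m ω)))

/-- The next flip is fair and independent of the past. -/
theorem setIntegral_heads_succ {m : ℕ} {A : Set Flips} (hA : MeasurableSet[flipFiltration m] A)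
    (g : ℕ → ℝ) :
    ∫ ω in A, g (heads (m + 1) ω) ∂coinMeasure =
      ∫ ω in A, (g (heads m ω) + g (heads m ω + 1)) / 2 ∂coinMeasure := by
  have hA' := flipFiltration.le m _ hA
  have hpre : toggle m ⁻¹' A = A := Set.ext (toggle_mem_iff hA)
  have hemb : MeasurableEmbedding (toggle m) := by
    have hinv : Function.Involutive (toggle m) := fun ω => by
      funext i; unfold toggle; split_ifs <;> simp
    exact (MeasurableEquiv.ofInvolutive _ hinv
      (measurePreserving_toggle m).measurable).measurableEmbedding
  have h1 := (measurePreserving_toggle m).setIntegral_preimage_emb hemb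
    (fun ω => g (heads (m + 1) ω)) A
  rw [hpre] at h1
  have hint : Integrable (fun ω => g (heads (m + 1) (toggle m ω))) coinMeasure :=
    (measurePreserving_toggle m).integrable_comp_of_integrable (integrable_comp_heads (m + 1) g)
  -- `A` does not see flip `m + 1`, so reversing that flip leaves the integral unchanged, and
  -- averaging the two versions runs through both outcomes.
  have h2 : ∫ ω in A, g (heads (m + 1) ω) ∂coinMeasure =
      (∫ ω in A, (g (heads (m + 1) ω) + g (heads (m + 1) (toggle m ω))) ∂coinMeasure) / 2 := by
    rw [integral_add (integrable_comp_heads _ g).integrableOn hint.integrableOn, h1]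
    ring
  rw [h2, ← integral_div]
  congr 1
  funext ω
  rw [heads_succ, heads_succ, heads_toggle]
  have : toggle m ω m = !ω m := by simp [toggle]
  rw [this]
  cases ω m <;> simp [add_comm]

/-- The process `f` stopped at the earlier of `m` and `τ`. -/
noncomputable def stoppedAt (f : ℕ → ℕ → ℝ) (τ : Flips → WithTop ℕ) (m : ℕ) (ω : Flips) : ℝ :=
  if τ ω ≤ WithTop.some m then f (τ ω).untopA (heads (τ ω).untopA ω) else f m (heads m ω)

theorem stoppedAt_zero (f : ℕ → ℕ → ℝ) (τ : Flips → WithTop ℕ) (ω : Flips) :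
    stoppedAt f τ 0 ω = f 0 0 := by
  unfold stoppedAt
  split_ifs with h
  · have : τ ω = 0 := by simpa using h
    simp [this, heads_zero]
  · rw [heads_zero]

theorem stoppedAt_succ (f : ℕ → ℕ → ℝ) (τ : Flips → WithTop ℕ) (m : ℕ) (ω : Flips) :
    stoppedAt f τ (m + 1) ω = stoppedAt f τ m ω +
      {ω | WithTop.some m < τ ω}.indicator
        (fun ω => f (m + 1) (heads (m + 1) ω) - f m (heads m ω)) ω := by
  unfold stoppedAt
  by_cases h : τ ω ≤ WithTop.some m
  · have h' : τ ω ≤ WithTop.some (m + 1) := h.trans (WithTop.coe_le_coe.2 (Nat.le_succ m))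
    rw [if_pos h, if_pos h', Set.indicator_of_notMem (by exact not_lt.2 h), add_zero]
  · have hlt := not_le.1 h
    rw [if_neg h, Set.indicator_of_mem (by exact hlt)]
    split_ifs with h'
    · have : τ ω = WithTop.some (m + 1) := by
        cases hτ : τ ω with
        | top => simp [hτ] at h'
        | coe t =>
          rw [hτ, WithTop.coe_le_coe] at h'
          rw [hτ, WithTop.coe_lt_coe] at hlt
          rw [le_antisymm h' hlt]
      rw [this, show (WithTop.some (m + 1)).untopA = m + 1 from rfl]
      ring
    · ring

variable {τ : Flips → WithTop ℕ}

theorem measurableSet_lt_stopping (hτ : IsStoppingTime flipFiltration τ) (m : ℕ) :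
    MeasurableSet[flipFiltration m] {ω | WithTop.some m < τ ω} := by
  have : {ω | WithTop.some m < τ ω} = {ω | τ ω ≤ WithTop.some m}ᶜ := by ext; simp
  rw [this]
  exact (hτ m).compl

theorem integrable_stoppedAt (hτ : IsStoppingTime flipFiltration τ) (f : ℕ → ℕ → ℝ) (m : ℕ) :
    Integrable (stoppedAt f τ m) coinMeasure := by
  induction m with
  | zero => simpa only [funext (stoppedAt_zero f τ)] using integrable_const _
  | succ m ih =>
    rw [funext (stoppedAt_succ f τ m)]
    exact ih.add (((integrable_comp_heads _ _).sub (integrable_comp_heads _ _)).indicator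
      (flipFiltration.le m _ (measurableSet_lt_stopping hτ m)))

/-- Optional stopping: the increment in `stoppedAt_succ` lives on the event `m < τ`, which is known
after `m` flips. Hence the supermartingale inequality is needed only on paths that have not stopped.
-/
theorem integral_stoppedAt_le (hτ : IsStoppingTime flipFiltration τ) (f : ℕ → ℕ → ℝ) (m : ℕ)
    (hf : ∀ j < m, ∀ ω, WithTop.some j < τ ω →
      (f (j + 1) (heads j ω) + f (j + 1) (heads j ω + 1)) / 2 ≤ f j (heads j ω)) :
    ∫ ω, stoppedAt f τ m ω ∂coinMeasure ≤ f 0 0 := by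
  induction m with
  | zero => simp [funext (stoppedAt_zero f τ)]
  | succ m ih =>
    have hA := measurableSet_lt_stopping hτ m
    have hA' := flipFiltration.le m _ hA
    have hi : Integrable (fun ω => f (m + 1) (heads (m + 1) ω) - f m (heads m ω)) coinMeasure :=
      (integrable_comp_heads _ _).sub (integrable_comp_heads _ _)
    simp only [stoppedAt_succ]
    rw [integral_add (integrable_stoppedAt hτ f m) (hi.indicator hA'), integral_indicator hA',
      integral_sub (integrable_comp_heads _ _).integrableOn
        (integrable_comp_heads _ _).integrableOn, setIntegral_heads_succ hA]
    have h1 := ih fun j hj => hf j (by omega)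
    have h2 : ∫ ω in {ω | WithTop.some m < τ ω},
        (f (m + 1) (heads m ω) + f (m + 1) (heads m ω + 1)) / 2 ∂coinMeasure ≤
        ∫ ω in {ω | WithTop.some m < τ ω}, f m (heads m ω) ∂coinMeasure :=
      setIntegral_mono_on
        (integrable_comp_heads m fun s => (f (m + 1) s + f (m + 1) (s + 1)) / 2).integrableOn
        (integrable_comp_heads m _).integrableOn hA' (hf m (by omega))
    linarith

theorem integral_stoppedAt_eq (hτ : IsStoppingTime flipFiltration τ) (f : ℕ → ℕ → ℝ) (m : ℕ)
    (hf : ∀ j < m, ∀ ω, WithTop.some j < τ ω →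
      (f (j + 1) (heads j ω) + f (j + 1) (heads j ω + 1)) / 2 = f j (heads j ω)) :
    ∫ ω, stoppedAt f τ m ω ∂coinMeasure = f 0 0 := by
  refine le_antisymm (integral_stoppedAt_le hτ f m fun j hj ω h => (hf j hj ω h).le) ?_
  have := integral_stoppedAt_le hτ (fun j s => -f j s) m
    fun j hj ω h => by linarith [hf j hj ω h]
  have e : stoppedAt (fun j s => -f j s) τ m = fun ω => -stoppedAt f τ m ω := by
    funext ω; unfold stoppedAt; split_ifs <;> rfl
  rw [e, integral_neg] at this
  linarith

/-- Every strategy that stops within `k` flips is dominated by the optimal one. -/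
theorem expectedPayoff_le {a n : ℕ} (han : a ≤ n) (hτ : IsStrategy τ) {r : ℝ}
    (hr : ∀ k, horizonProportion k a n ≤ r) : expectedPayoff a n τ ≤ r := by
  set gain : ℕ → ℕ → ℝ := fun j s => ((a : ℝ) + s) / (n + j) with hgain
  -- Stopping at the earlier of `τ` and `m` is within the reach of the recursion with horizon `m`.
  have hle : ∀ m, ∫ ω, stoppedAt gain τ m ω ∂coinMeasure ≤ r := by
    intro m
    set f : ℕ → ℕ → ℝ := fun j s => horizonProportion (m - j) (a + s) (n + j) with hf
    have hgf : ∀ j s, gain j s ≤ f j s := fun j s => by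
      have := div_le_horizonProportion (m - j) (a + s) (n + j)
      push_cast at this
      exact this
    calc ∫ ω, stoppedAt gain τ m ω ∂coinMeasure ≤ ∫ ω, stoppedAt f τ m ω ∂coinMeasure := by
          refine integral_mono (integrable_stoppedAt hτ.1 _ m) (integrable_stoppedAt hτ.1 _ m) ?_
          intro ω
          simp only [stoppedAt]
          split_ifs <;> exact hgf _ _
      _ ≤ f 0 0 := by
          refine integral_stoppedAt_le hτ.1 f m fun j hj ω _ => ?_
          have e : m - j = (m - (j + 1)) + 1 := by omega
          simp only [hf]
          rw [e]
          exact le_max_right _ _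
      _ ≤ r := hr m
  have hbound : ∀ j ω, ‖gain j (heads j ω)‖ ≤ 1 := by
    intro j ω
    have h1 : (a : ℝ) ≤ n := by exact_mod_cast han
    have h2 : (heads j ω : ℝ) ≤ j := by exact_mod_cast heads_le j ω
    rw [Real.norm_of_nonneg (by positivity)]
    exact div_le_one_of_le₀ (by linarith) (by positivity)
  -- The payoffs lie in `[0, 1]` and `τ` is almost surely finite, so the truncated payoffs converge
  -- boundedly.
  have hlim : Filter.Tendsto (fun m => ∫ ω, stoppedAt gain τ m ω ∂coinMeasure) Filter.atTop
      (nhds (expectedPayoff a n τ)) := by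
    refine tendsto_integral_of_dominated_convergence (fun _ => 1)
      (fun m => (integrable_stoppedAt hτ.1 _ m).aestronglyMeasurable) (integrable_const _)
      (fun m => Filter.Eventually.of_forall fun ω => ?_) ?_
    · simp only [stoppedAt]
      split_ifs <;> exact hbound _ _
    · filter_upwards [hτ.2] with ω hω
      obtain ⟨t, ht⟩ := WithTop.ne_top_iff_exists.1 hω
      refine tendsto_const_nhds.congr' ?_
      filter_upwards [Filter.eventually_ge_atTop t] with m hm
      simp only [stoppedAt, ← ht]
      rw [if_pos (by exact WithTop.coe_le_coe.2 hm)]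
      simp [stoppedValue, proportion, ← ht, hgain]
  exact le_of_tendsto' hlim hle

theorem V_le {a n : ℕ} (han : a ≤ n) {r : ℝ} (hr : ∀ k, horizonProportion k a n ≤ r) :
    V a n ≤ r := by
  refine csSup_le ⟨_, fun _ => WithTop.some 0, ⟨isStoppingTime_const _ _, by simp⟩, rfl⟩ ?_
  rintro _ ⟨τ, hτ, rfl⟩
  exact expectedPayoff_le han hτ hr

/-- Stop at the first time the remaining-horizon value equals the payoff, which happens by flip `k`
at the latest. Before that time the value is the average of its successors, so the stopped value is
a martingale. -/
theorem exists_strategy (k a n : ℕ) :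
    ∃ τ, IsStrategy τ ∧ expectedPayoff a n τ = horizonProportion k a n := by
  classical
  set f : ℕ → ℕ → ℝ := fun j s => horizonProportion (k - j) (a + s) (n + j) with hf
  set gain : ℕ → ℕ → ℝ := fun j s => ((a : ℝ) + s) / (n + j) with hgain
  have hex : ∀ ω : Flips, ∃ j, f j (heads j ω) = gain j (heads j ω) :=
    fun ω => ⟨k, by simp [hf, hgain, horizonProportion]⟩
  set T : Flips → ℕ := fun ω => Nat.find (hex ω) with hT
  have hTk : ∀ ω, T ω ≤ k := fun ω => Nat.find_le (by simp [hf, hgain, horizonProportion])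
  set τ : Flips → WithTop ℕ := fun ω => WithTop.some (T ω) with hτdef
  have hstopping : IsStoppingTime flipFiltration τ := by
    intro i
    have : {ω | τ ω ≤ WithTop.some i} = ⋃ j ∈ Finset.range (i + 1),
        heads j ⁻¹' {s | f j s = gain j s} := by
      ext ω
      simp only [hτdef, hT, Set.mem_ofPred_eq, WithTop.coe_le_coe, Nat.find_le_iff,
        Set.mem_iUnion, Finset.mem_range, Nat.lt_succ_iff, Set.mem_preimage, exists_prop]
    rw [this]
    refine Finset.measurableSet_biUnion _ fun j hj => ?_
    refine flipFiltration.mono (Nat.lt_succ_iff.1 (Finset.mem_range.1 hj)) _ ?_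
    exact measurable_heads j (Set.to_countable _).measurableSet
  refine ⟨τ, ⟨hstopping, by simp [hτdef]⟩, ?_⟩
  have h := integral_stoppedAt_eq hstopping f k fun j hj ω hlt => by
    have hjT : j < T ω := by simpa [hτdef] using hlt
    have hne := Nat.find_min (hex ω) hjT
    have e : k - j = (k - (j + 1)) + 1 := by omega
    simp only [hf, hgain] at hne ⊢
    rw [e] at hne ⊢
    simp only [horizonProportion] at hne ⊢
    rcases max_choice (((a + heads j ω : ℕ) : ℝ) / (n + j : ℕ))
      ((horizonProportion (k - (j + 1)) (a + heads j ω) (n + j + 1) +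
        horizonProportion (k - (j + 1)) (a + heads j ω + 1) (n + j + 1)) / 2) with h | h
    · rw [h] at hne
      push_cast at hne
      exact absurd rfl hne
    · rw [h]; rfl
  have h0 : f 0 0 = horizonProportion k a n := by simp [hf]
  rw [← h0, ← h]
  unfold expectedPayoff
  congr 1
  funext ω
  have hspec := Nat.find_spec (hex ω)
  have hle : τ ω ≤ WithTop.some k := by simpa [hτdef] using hTk ω
  simp only [stoppedAt, if_pos hle, stoppedValue, proportion]
  exact hspec.symm

theorem horizonProportion_le_V (k : ℕ) {a n : ℕ} (han : a ≤ n) :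
    horizonProportion k a n ≤ V a n := by
  obtain ⟨τ, hτ, h⟩ := exists_strategy k a n
  refine le_csSup ⟨1, ?_⟩ ⟨τ, hτ, h.symm⟩
  rintro _ ⟨σ, hσ, rfl⟩
  refine expectedPayoff_le han hσ fun k => ?_
  clear h hτ τ
  induction k generalizing a n with
  | zero =>
    exact div_le_one_of_le₀ (by exact_mod_cast han) (by positivity)
  | succ k ih =>
    refine max_le (div_le_one_of_le₀ (by exact_mod_cast han) (by positivity)) ?_
    linarith [ih (a := a) (n := n + 1) (by omega), ih (a := a + 1) (n := n + 1) (by omega)]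

theorem V_eq_diffValue {a n : ℕ} (han : a ≤ n) (hn : 1 ≤ n) :
    V a n = (1 + diffValue (2 * a - n) n) / 2 := by
  apply le_antisymm
  · refine V_le han fun k => ?_
    rw [horizonProportion_eq k a hn]
    linarith [horizonValue_le_diffValue k (2 * a - n) hn]
  · have h : diffValue (2 * a - n) n ≤ 2 * V a n - 1 := ciSup_le fun k => by
      have := horizonProportion_le_V k han
      rw [horizonProportion_eq k a hn] at this
      linarith
    linarith

theorem div_eq_diff {a n : ℕ} (hn : 1 ≤ n) :
    (a : ℝ) / n = (1 + ((2 * a - n : ℤ) : ℝ) / n) / 2 := horizonProportion_eq 0 a hn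

theorem stoppingOptimal_of_diffValue_le {a n : ℕ} (han : a ≤ n) (hn : 1 ≤ n)
    (h : diffValue (2 * a - n) n ≤ ((2 * a - n : ℤ) : ℝ) / n) : StoppingOptimal a n := by
  unfold StoppingOptimal
  rw [V_eq_diffValue han hn, div_eq_diff hn, le_antisymm h (div_le_diffValue _ hn)]

theorem continuingBetter_of_lt_diffValue {a n : ℕ} (han : a ≤ n) (hn : 1 ≤ n)
    (h : ((2 * a - n : ℤ) : ℝ) / n < diffValue (2 * a - n) n) : ContinuingBetter a n := by
  unfold ContinuingBetter
  rw [V_eq_diffValue han hn, div_eq_diff hn]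
  linarith

/-- With at least as many tails as heads, continuing is better. -/
theorem continuingBetter_of_nonpos {a n : ℕ} (han : a ≤ n) (h : 2 * (a : ℤ) - n ≤ 0) :
    ContinuingBetter a n := by
  rcases Nat.eq_zero_or_pos n with rfl | hn
  · obtain rfl : a = 0 := by omega
    -- Before the first flip stopping pays `0 / 0 = 0`, while a single flip is worth `1 / 2`.
    have := horizonProportion_le_V 1 (le_refl 0)
    unfold ContinuingBetter
    refine lt_of_lt_of_le ?_ this
    simp [horizonProportion]
  · refine continuingBetter_of_lt_diffValue han hn ?_
    refine div_lt_diffValue_of_le h hn ?_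
    -- From difference `0`, stop after a head and flip once more after a tail: this earns half of `1
    -- / (n + 1) - 1 / (n + 2)`.
    refine lt_of_lt_of_le ?_ (average_le_diffValue 0 hn)
    have h1 := div_le_diffValue 1 (n := n + 1) (by omega)
    have h2 := (average_le_diffValue (-1) (n := n + 1) (by omega))
    have h3 := div_le_diffValue 0 (n := n + 1 + 1) (by omega)
    have h4 := div_le_diffValue (-2) (n := n + 1 + 1) (by omega)
    norm_num at h1 h2 h3 h4 ⊢
    have h5 : (-1 : ℝ) / (n + 1 + 1) + 1 / (n + 1) > 0 := by
      rw [gt_iff_lt, div_add_div _ _ (by positivity) (by positivity)]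
      apply div_pos <;> nlinarith
    have h6 : (-2 : ℝ) / (n + 1 + 1) = 2 * (-1 / (n + 1 + 1)) := by ring
    have h7 : (1 : ℝ) / (n + 1) = ((n : ℝ) + 1)⁻¹ := one_div _
    linarith

/-! ### Taylor inequalities for exp and cosh. -/

theorem nonneg_of_hasDerivAt_nonneg {f f' : ℝ → ℝ} (h0 : 0 ≤ f 0)
    (hf : ∀ t, HasDerivAt f (f' t) t) (hf' : ∀ t, 0 ≤ t → 0 ≤ f' t) {t : ℝ} (ht : 0 ≤ t) :
    0 ≤ f t := by
  have hmono : MonotoneOn f (Set.Ici 0) := by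
    refine monotoneOn_of_deriv_nonneg (convex_Ici 0)
      (fun s _ => (hf s).continuousAt.continuousWithinAt)
      (fun s _ => (hf s).differentiableAt.differentiableWithinAt) fun s hs => ?_
    rw [interior_Ici] at hs
    rw [(hf s).deriv]
    exact hf' s (le_of_lt hs)
  exact h0.trans (hmono (Set.mem_Ici.2 le_rfl) (Set.mem_Ici.2 ht) ht)

theorem hasDerivAt_exp_neg (t : ℝ) : HasDerivAt (fun t => Real.exp (-t)) (-Real.exp (-t)) t := by
  simpa using (hasDerivAt_neg t).exp

theorem exp_neg_le_quadratic {t : ℝ} (ht : 0 ≤ t) : Real.exp (-t) ≤ 1 - t + t ^ 2 / 2 := by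
  have := nonneg_of_hasDerivAt_nonneg (f := fun t => 1 - t + t ^ 2 / 2 - Real.exp (-t))
    (f' := fun t => -1 + t + Real.exp (-t)) (by simp)
    (fun t => by
      have h1 : HasDerivAt (fun t : ℝ => 1 - t + t ^ 2 / 2) (-1 + t) t := by
        exact HasDerivAt.congr_deriv (((hasDerivAt_id t).const_sub 1).add ((hasDerivAt_pow 2 t).div_const 2))
          (by simp)
      exact HasDerivAt.congr_deriv (h1.sub (hasDerivAt_exp_neg t)) (by ring))
    (fun t _ => by linarith [Real.add_one_le_exp (-t)]) ht
  linarith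

theorem cubic_le_exp_neg {t : ℝ} (ht : 0 ≤ t) :
    1 - t + t ^ 2 / 2 - t ^ 3 / 6 ≤ Real.exp (-t) := by
  have := nonneg_of_hasDerivAt_nonneg
    (f := fun t => Real.exp (-t) - (1 - t + t ^ 2 / 2 - t ^ 3 / 6))
    (f' := fun t => -Real.exp (-t) - (-1 + t - t ^ 2 / 2)) (by simp)
    (fun t => by
      have h1 : HasDerivAt (fun t : ℝ => 1 - t + t ^ 2 / 2 - t ^ 3 / 6) (-1 + t - t ^ 2 / 2) t := by
        exact HasDerivAt.congr_deriv ((((hasDerivAt_id t).const_sub 1).add ((hasDerivAt_pow 2 t).div_const 2)).sub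
          ((hasDerivAt_pow 3 t).div_const 6))
          (by simp; ring)
      exact (hasDerivAt_exp_neg t).sub h1)
    (fun t ht => by linarith [exp_neg_le_quadratic ht]) ht
  linarith

theorem exp_neg_le_quartic {t : ℝ} (ht : 0 ≤ t) :
    Real.exp (-t) ≤ 1 - t + t ^ 2 / 2 - t ^ 3 / 6 + t ^ 4 / 24 := by
  have := nonneg_of_hasDerivAt_nonneg
    (f := fun t => 1 - t + t ^ 2 / 2 - t ^ 3 / 6 + t ^ 4 / 24 - Real.exp (-t))
    (f' := fun t => (-1 + t - t ^ 2 / 2 + t ^ 3 / 6) + Real.exp (-t)) (by simp)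
    (fun t => by
      have h1 : HasDerivAt (fun t : ℝ => 1 - t + t ^ 2 / 2 - t ^ 3 / 6 + t ^ 4 / 24)
          (-1 + t - t ^ 2 / 2 + t ^ 3 / 6) t := by
        exact HasDerivAt.congr_deriv (((((hasDerivAt_id t).const_sub 1).add ((hasDerivAt_pow 2 t).div_const 2)).sub
          ((hasDerivAt_pow 3 t).div_const 6)).add ((hasDerivAt_pow 4 t).div_const 24))
          (by simp; ring)
      exact HasDerivAt.congr_deriv (h1.sub (hasDerivAt_exp_neg t)) (by ring))
    (fun t ht => by linarith [cubic_le_exp_neg ht]) ht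
  linarith

theorem quadratic_le_cosh {t : ℝ} (ht : 0 ≤ t) : 1 + t ^ 2 / 2 ≤ Real.cosh t := by
  have := nonneg_of_hasDerivAt_nonneg
    (f := fun t => Real.cosh t - (1 + t ^ 2 / 2)) (f' := fun t => Real.sinh t - t) (by simp)
    (fun t => by
      have h1 : HasDerivAt (fun t : ℝ => 1 + t ^ 2 / 2) t t := by
        exact HasDerivAt.congr_deriv (((hasDerivAt_pow 2 t).div_const 2).const_add 1)
          (by simp)
      exact (Real.hasDerivAt_cosh t).sub h1)
    (fun t ht => by linarith [Real.self_le_sinh_iff.2 ht]) ht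
  linarith

theorem cubic_le_sinh {t : ℝ} (ht : 0 ≤ t) : t + t ^ 3 / 6 ≤ Real.sinh t := by
  have := nonneg_of_hasDerivAt_nonneg
    (f := fun t => Real.sinh t - (t + t ^ 3 / 6)) (f' := fun t => Real.cosh t - (1 + t ^ 2 / 2))
    (by simp)
    (fun t => by
      have h1 : HasDerivAt (fun t : ℝ => t + t ^ 3 / 6) (1 + t ^ 2 / 2) t := by
        exact HasDerivAt.congr_deriv ((hasDerivAt_id t).add ((hasDerivAt_pow 3 t).div_const 6))
          (by simp; ring)
      exact (Real.hasDerivAt_sinh t).sub h1)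
    (fun t ht => by linarith [quadratic_le_cosh ht]) ht
  linarith

theorem quartic_le_cosh {t : ℝ} (ht : 0 ≤ t) : 1 + t ^ 2 / 2 + t ^ 4 / 24 ≤ Real.cosh t := by
  have := nonneg_of_hasDerivAt_nonneg
    (f := fun t => Real.cosh t - (1 + t ^ 2 / 2 + t ^ 4 / 24))
    (f' := fun t => Real.sinh t - (t + t ^ 3 / 6)) (by simp)
    (fun t => by
      have h1 : HasDerivAt (fun t : ℝ => 1 + t ^ 2 / 2 + t ^ 4 / 24) (t + t ^ 3 / 6) t := by
        exact HasDerivAt.congr_deriv ((((hasDerivAt_pow 2 t).div_const 2).const_add 1).add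
          ((hasDerivAt_pow 4 t).div_const 24))
          (by simp; ring)
      exact (Real.hasDerivAt_cosh t).sub h1)
    (fun t ht => by linarith [cubic_le_sinh ht]) ht
  linarith

/-- For `u = t ^ 2 / 2` the bracket is the quartic Taylor polynomial of `cosh t` and the left side
is `1 - t ^ 4 / 12`. -/
theorem one_sub_le_exp_neg_mul {u : ℝ} (hu : 0 ≤ u) :
    1 - u ^ 2 / 3 ≤ Real.exp (-u) * (1 + u + u ^ 2 / 6) := by
  have := nonneg_of_hasDerivAt_nonneg
    (f := fun u => Real.exp (-u) * (1 + u + u ^ 2 / 6) - (1 - u ^ 2 / 3))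
    (f' := fun u => 2 * u / 3 * (1 - Real.exp (-u) * (1 + u / 4))) (by simp)
    (fun u => by
      have h1 : HasDerivAt (fun u : ℝ => 1 + u + u ^ 2 / 6) (1 + u / 3) u := by
        exact HasDerivAt.congr_deriv (((hasDerivAt_id u).const_add 1).add ((hasDerivAt_pow 2 u).div_const 6))
          (by simp; ring)
      have h2 : HasDerivAt (fun u : ℝ => 1 - u ^ 2 / 3) (-(2 * u / 3)) u := by
        exact HasDerivAt.congr_deriv (((hasDerivAt_pow 2 u).div_const 3).const_sub 1)
          (by simp)
      exact HasDerivAt.congr_deriv (((hasDerivAt_exp_neg u).mul h1).sub h2) (by ring))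
    (fun u hu => by
      have h1 : Real.exp (-u) * (1 + u / 4) ≤ Real.exp (-u) * Real.exp u := by
        gcongr
        linarith [Real.add_one_le_exp u]
      rw [← Real.exp_add, neg_add_cancel, Real.exp_zero] at h1
      have : 0 ≤ 1 - Real.exp (-u) * (1 + u / 4) := by linarith
      positivity) hu
  linarith

/-- A lower bound complementing `Real.cosh_le_exp_half_sq`. -/
theorem one_sub_le_cosh_mul_exp {t : ℝ} (ht : 0 ≤ t) :
    1 - t ^ 4 / 12 ≤ Real.cosh t * Real.exp (-(t ^ 2 / 2)) := by
  have h1 := one_sub_le_exp_neg_mul (u := t ^ 2 / 2) (by positivity)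
  have h2 : Real.exp (-(t ^ 2 / 2)) * (1 + t ^ 2 / 2 + (t ^ 2 / 2) ^ 2 / 6) ≤
      Real.exp (-(t ^ 2 / 2)) * Real.cosh t := by
    gcongr
    linarith [quartic_le_cosh ht]
  nlinarith

/-! ### Gaussian integrals over the half-line. -/

/-- The moments of the weight `exp (l x - l² n / 2)` on the half-line. -/
noncomputable def gaussMoment (k : ℕ) (x n : ℝ) : ℝ :=
  ∫ l in Set.Ioi (0 : ℝ), l ^ k * Real.exp (l * x - l ^ 2 * n / 2)

theorem integrableOn_gaussMoment (k : ℕ) (x : ℝ) {n : ℝ} (hn : 0 < n) :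
    IntegrableOn (fun l : ℝ => l ^ k * Real.exp (l * x - l ^ 2 * n / 2)) (Set.Ioi 0) := by
  have h := (integrableOn_rpow_mul_exp_neg_mul_sq (b := n / 4) (by positivity)
    (s := k) (by linarith [(Nat.cast_nonneg k : (0 : ℝ) ≤ k)])).const_mul (Real.exp (x ^ 2 / n))
  refine Integrable.mono' h (by fun_prop) ?_
  refine (ae_restrict_iff' measurableSet_Ioi).2 (Filter.Eventually.of_forall fun l hl => ?_)
  have hl0 : (0 : ℝ) < l := hl
  rw [Real.norm_of_nonneg (by positivity), Real.rpow_natCast, mul_left_comm, ← Real.exp_add]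
  gcongr
  -- Completing the square gives `l x ≤ x² / n + n l² / 4`, which leaves half of the Gaussian decay.
  have : x ^ 2 / n + -(n / 4) * l ^ 2 - (l * x - l ^ 2 * n / 2) = (x - l * n / 2) ^ 2 / n := by
    field_simp
    ring
  have : 0 ≤ (x - l * n / 2) ^ 2 / n := by positivity
  linarith

theorem hasDerivAt_weight (x n l : ℝ) :
    HasDerivAt (fun l => Real.exp (l * x - l ^ 2 * n / 2))
      ((x - l * n) * Real.exp (l * x - l ^ 2 * n / 2)) l := by
  have h : HasDerivAt (fun l : ℝ => l * x - l ^ 2 * n / 2) (x - l * n) l := by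
    exact HasDerivAt.congr_deriv (((hasDerivAt_id l).mul_const x).sub
      (((hasDerivAt_pow 2 l).mul_const n).div_const 2))
      (by simp; ring)
  exact HasDerivAt.congr_deriv (h.exp) (by ring)

/-- Integrate the derivative of the weight, which is `x - l n` times the weight; the boundary value
at `0` yields the summand `1`. -/
theorem gaussMoment_one (x : ℝ) {n : ℝ} (hn : 0 < n) :
    n * gaussMoment 1 x n = x * gaussMoment 0 x n + 1 := by
  have i0 := integrableOn_gaussMoment 0 x hn
  have i1 := integrableOn_gaussMoment 1 x hn
  simp only [pow_zero, one_mul] at i0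
  have hint : IntegrableOn (fun l : ℝ => (x - l * n) * Real.exp (l * x - l ^ 2 * n / 2))
      (Set.Ioi 0) := by
    refine ((i0.const_mul x).sub (i1.const_mul n)).congr (Filter.Eventually.of_forall fun l => ?_)
    simp only [Pi.sub_apply]
    ring
  have hd := fun l (_ : l ∈ Set.Ici (0 : ℝ)) => hasDerivAt_weight x n l
  have h := integral_Ioi_of_hasDerivAt_of_tendsto' hd hint
    (tendsto_zero_of_hasDerivAt_of_integrableOn_Ioi
      (fun l hl => hd l (Set.mem_Ici.2 (le_of_lt hl))) hint i0)
  have e : ∫ l in Set.Ioi (0 : ℝ), (x - l * n) * Real.exp (l * x - l ^ 2 * n / 2) =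
      x * gaussMoment 0 x n - n * gaussMoment 1 x n := by
    unfold gaussMoment
    rw [← integral_const_mul, ← integral_const_mul, ← integral_sub (by simpa using i0.const_mul x)
      (i1.const_mul n)]
    congr 1
    funext l
    ring
  rw [e] at h
  simp at h
  linarith

/-- Integrate the derivative of `l ^ (k + 1)` times the weight, which vanishes at both ends.
Together with `gaussMoment_one` this reduces all moments to the zeroth. -/
theorem gaussMoment_add_two (k : ℕ) (x : ℝ) {n : ℝ} (hn : 0 < n) :
    n * gaussMoment (k + 2) x n = x * gaussMoment (k + 1) x n + (k + 1) * gaussMoment k x n := by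
  have i0 := integrableOn_gaussMoment k x hn
  have i1 := integrableOn_gaussMoment (k + 1) x hn
  have i2 := integrableOn_gaussMoment (k + 2) x hn
  have key : ∀ l : ℝ, ((k + 1 : ℕ) : ℝ) * l ^ k * Real.exp (l * x - l ^ 2 * n / 2) +
      l ^ (k + 1) * ((x - l * n) * Real.exp (l * x - l ^ 2 * n / 2)) =
      (x * (l ^ (k + 1) * Real.exp (l * x - l ^ 2 * n / 2)) +
        (k + 1) * (l ^ k * Real.exp (l * x - l ^ 2 * n / 2))) -
        n * (l ^ (k + 2) * Real.exp (l * x - l ^ 2 * n / 2)) := by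
    intro l
    push_cast
    ring
  have hd : ∀ l ∈ Set.Ici (0 : ℝ), HasDerivAt
      (fun l => l ^ (k + 1) * Real.exp (l * x - l ^ 2 * n / 2))
      (((k + 1 : ℕ) : ℝ) * l ^ k * Real.exp (l * x - l ^ 2 * n / 2) +
        l ^ (k + 1) * ((x - l * n) * Real.exp (l * x - l ^ 2 * n / 2))) l :=
    fun l _ => (hasDerivAt_pow (k + 1) l).mul (hasDerivAt_weight x n l)
  simp only [key] at hd
  have hint := ((i1.const_mul x).add (i0.const_mul (k + 1 : ℝ))).sub (i2.const_mul n)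
  have h := integral_Ioi_of_hasDerivAt_of_tendsto' hd hint
    (tendsto_zero_of_hasDerivAt_of_integrableOn_Ioi
      (fun l hl => hd l (Set.mem_Ici.2 (le_of_lt hl))) hint i1)
  have h := (integral_sub' ((i1.const_mul x).add (i0.const_mul (k + 1 : ℝ)))
    (i2.const_mul n)).symm.trans h
  rw [integral_add' (i1.const_mul x) (i0.const_mul (k + 1 : ℝ)), integral_const_mul,
    integral_const_mul, integral_const_mul] at h
  simp only [gaussMoment]
  simp at h
  linarith

/-- Scaling. -/
theorem gaussMoment_zero_mul {s : ℝ} (hs : 0 < s) (z : ℝ) :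
    gaussMoment 0 (z * s) (s ^ 2) = gaussMoment 0 z 1 / s := by
  unfold gaussMoment
  have h := integral_comp_mul_left_Ioi
    (fun l : ℝ => l ^ 0 * Real.exp (l * z - l ^ 2 * 1 / 2)) 0 hs
  rw [mul_zero, smul_eq_mul] at h
  rw [div_eq_inv_mul, ← h]
  congr 1
  funext l
  rw [pow_zero, pow_zero]
  congr 2
  ring

theorem gaussMoment_nonneg (k : ℕ) (x n : ℝ) : 0 ≤ gaussMoment k x n :=
  setIntegral_nonneg measurableSet_Ioi fun l hl => by
    have : (0 : ℝ) < l := hl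
    positivity

theorem gaussMoment_mono_left (k : ℕ) {x y : ℝ} (hxy : x ≤ y) {n : ℝ} (hn : 0 < n) :
    gaussMoment k x n ≤ gaussMoment k y n :=
  setIntegral_mono_on (integrableOn_gaussMoment k x hn) (integrableOn_gaussMoment k y hn)
    measurableSet_Ioi fun l hl => by
      have : (0 : ℝ) < l := hl
      gcongr

/-- The integral of a quartic polynomial against the weight. -/
theorem integral_quartic (a₀ a₁ a₂ a₃ a₄ x : ℝ) {n : ℝ} (hn : 0 < n) :
    IntegrableOn (fun l : ℝ => (a₀ + a₁ * l + a₂ * l ^ 2 + a₃ * l ^ 3 + a₄ * l ^ 4) *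
      Real.exp (l * x - l ^ 2 * n / 2)) (Set.Ioi 0) ∧
    ∫ l in Set.Ioi (0 : ℝ), (a₀ + a₁ * l + a₂ * l ^ 2 + a₃ * l ^ 3 + a₄ * l ^ 4) *
      Real.exp (l * x - l ^ 2 * n / 2) =
      a₀ * gaussMoment 0 x n + a₁ * gaussMoment 1 x n + a₂ * gaussMoment 2 x n +
        a₃ * gaussMoment 3 x n + a₄ * gaussMoment 4 x n := by
  have j0 := (integrableOn_gaussMoment 0 x hn).const_mul a₀
  have j1 := (integrableOn_gaussMoment 1 x hn).const_mul a₁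
  have j2 := (integrableOn_gaussMoment 2 x hn).const_mul a₂
  have j3 := (integrableOn_gaussMoment 3 x hn).const_mul a₃
  have j4 := (integrableOn_gaussMoment 4 x hn).const_mul a₄
  have e : (fun l : ℝ => (a₀ + a₁ * l + a₂ * l ^ 2 + a₃ * l ^ 3 + a₄ * l ^ 4) *
      Real.exp (l * x - l ^ 2 * n / 2)) = fun l : ℝ =>
        a₀ * (l ^ 0 * Real.exp (l * x - l ^ 2 * n / 2)) +
        a₁ * (l ^ 1 * Real.exp (l * x - l ^ 2 * n / 2)) +
        a₂ * (l ^ 2 * Real.exp (l * x - l ^ 2 * n / 2)) +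
        a₃ * (l ^ 3 * Real.exp (l * x - l ^ 2 * n / 2)) +
        a₄ * (l ^ 4 * Real.exp (l * x - l ^ 2 * n / 2)) := by
    funext l
    ring
  rw [e]
  refine ⟨(((j0.add j1).add j2).add j3).add j4, ?_⟩
  refine (integral_add' (((j0.add j1).add j2).add j3) j4).trans ?_
  rw [integral_add' ((j0.add j1).add j2) j3, integral_add' (j0.add j1) j2, integral_add' j0 j1]
  simp only [integral_const_mul, gaussMoment]

/-- Moving `x` by `h` multiplies the weight by `exp (l h)`; a quartic bound for this factor bounds
the shifted integral by moments at `x`. -/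
theorem gaussMoment_ge_of_quartic {a₀ a₁ a₂ a₃ a₄ h : ℝ}
    (hq : ∀ l : ℝ, 0 ≤ l → a₀ + a₁ * l + a₂ * l ^ 2 + a₃ * l ^ 3 + a₄ * l ^ 4 ≤ Real.exp (l * h))
    (x : ℝ) {n : ℝ} (hn : 0 < n) :
    a₀ * gaussMoment 0 x n + a₁ * gaussMoment 1 x n + a₂ * gaussMoment 2 x n +
      a₃ * gaussMoment 3 x n + a₄ * gaussMoment 4 x n ≤ gaussMoment 0 (x + h) n := by
  obtain ⟨hi, he⟩ := integral_quartic a₀ a₁ a₂ a₃ a₄ x hn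
  rw [← he]
  refine setIntegral_mono_on hi (integrableOn_gaussMoment 0 _ hn) measurableSet_Ioi fun l hl => ?_
  have e : l * (x + h) - l ^ 2 * n / 2 = l * h + (l * x - l ^ 2 * n / 2) := by ring
  rw [e, Real.exp_add, pow_zero, one_mul]
  gcongr
  exact hq l (le_of_lt hl)

theorem gaussMoment_le_of_quartic {a₀ a₁ a₂ a₃ a₄ h : ℝ}
    (hq : ∀ l : ℝ, 0 ≤ l → Real.exp (l * h) ≤ a₀ + a₁ * l + a₂ * l ^ 2 + a₃ * l ^ 3 + a₄ * l ^ 4)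
    (x : ℝ) {n : ℝ} (hn : 0 < n) :
    gaussMoment 0 (x + h) n ≤
      a₀ * gaussMoment 0 x n + a₁ * gaussMoment 1 x n + a₂ * gaussMoment 2 x n +
      a₃ * gaussMoment 3 x n + a₄ * gaussMoment 4 x n := by
  obtain ⟨hi, he⟩ := integral_quartic a₀ a₁ a₂ a₃ a₄ x hn
  rw [← he]
  refine setIntegral_mono_on (integrableOn_gaussMoment 0 _ hn) hi measurableSet_Ioi fun l hl => ?_
  have e : l * (x + h) - l ^ 2 * n / 2 = l * h + (l * x - l ^ 2 * n / 2) := by ring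
  rw [e, Real.exp_add, pow_zero, one_mul]
  gcongr
  exact hq l (le_of_lt hl)

/-- Convexity in `x`: the first moment is the derivative of the zeroth. -/
theorem gaussMoment_tangent (x h : ℝ) {n : ℝ} (hn : 0 < n) :
    gaussMoment 0 x n + h * gaussMoment 1 x n ≤ gaussMoment 0 (x + h) n := by
  have := gaussMoment_ge_of_quartic (a₀ := 1) (a₁ := h) (a₂ := 0) (a₃ := 0) (a₄ := 0) (h := h)
    (fun l _ => by linarith [Real.add_one_le_exp (l * h)]) x hn
  linarith

/-! ### Numerical value of the integral near the boundary. -/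

theorem gaussMoment_zero_zero : gaussMoment 0 0 1 = √(Real.pi / 2) := by
  have h := integral_gaussian_Ioi (1 / 2)
  have e : √(Real.pi / (1 / 2)) / 2 = √(Real.pi / 2) := by
    have : Real.pi / (1 / 2) = 2 ^ 2 * (Real.pi / 2) := by ring
    rw [this, Real.sqrt_mul (by norm_num), Real.sqrt_sq (by norm_num)]
    ring
  rw [← e, ← h]
  unfold gaussMoment
  congr 1
  funext l
  rw [pow_zero, one_mul]
  congr 1
  ring

theorem sqrt_pi_div_two_bounds :
    1.2533140 < √(Real.pi / 2) ∧ √(Real.pi / 2) < 1.2533143 := by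
  constructor
  · rw [Real.lt_sqrt (by norm_num)]
    linarith [Real.pi_gt_d6]
  · rw [Real.sqrt_lt' (by norm_num)]
    linarith [Real.pi_lt_d6]

/-- Complete the square, `l z - l² / 2 = z² / 2 - (l - z)² / 2`, shift, and split the half-line at
`0`. -/
theorem gaussMoment_eq_integral (z : ℝ) :
    gaussMoment 0 z 1 = Real.exp (z ^ 2 / 2) *
      ((∫ t in (-z)..0, Real.exp (-(t ^ 2 / 2))) + √(Real.pi / 2)) := by
  have hmp := (measurePreserving_sub_right volume z).setIntegral_preimage_emb
    (measurableEmbedding_subRight z) (fun t : ℝ => Real.exp (-(t ^ 2 / 2))) (Set.Ioi (-z))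
  have hpre : (fun x => x - z) ⁻¹' Set.Ioi (-z) = Set.Ioi (0 : ℝ) := by
    ext x
    simp
  rw [hpre] at hmp
  have hint : Integrable (fun t : ℝ => Real.exp (-(t ^ 2 / 2))) := by
    refine (integrable_exp_neg_mul_sq (b := 1 / 2) (by norm_num)).congr
      (Filter.Eventually.of_forall fun t => ?_)
    simp only
    congr 1
    ring
  have hsplit := intervalIntegral.integral_interval_add_Ioi (a := -z) (b := 0)
    hint.integrableOn hint.integrableOn
  have h0 : ∫ t in Set.Ioi (0 : ℝ), Real.exp (-(t ^ 2 / 2)) = √(Real.pi / 2) := by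
    rw [← gaussMoment_zero_zero]
    unfold gaussMoment
    congr 1
    funext l
    rw [pow_zero, one_mul]
    congr 1
    ring
  rw [← h0, hsplit, ← hmp, ← integral_const_mul]
  unfold gaussMoment
  congr 1
  funext l
  rw [pow_zero, one_mul, ← Real.exp_add]
  congr 1
  ring

theorem abs_exp_neg_sq_sub_le {t : ℝ} (ht : t ^ 2 ≤ 1) :
    |Real.exp (-(t ^ 2 / 2)) - (1 - t ^ 2 / 2 + t ^ 4 / 8 - t ^ 6 / 48 + t ^ 8 / 384 -
      t ^ 10 / 3840)| ≤ t ^ 12 / 39497 := by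
  have h := Real.exp_bound (x := -(t ^ 2 / 2))
    (by rw [abs_neg, abs_of_nonneg (by positivity)]; linarith) (n := 6) (by norm_num)
  rw [abs_neg, abs_of_nonneg (a := t ^ 2 / 2) (by positivity)] at h
  simp only [Finset.sum_range_succ, Finset.sum_range_zero, Nat.factorial] at h
  norm_num at h
  have e : (1 - t ^ 2 / 2 + t ^ 4 / 8 - t ^ 6 / 48 + t ^ 8 / 384 - t ^ 10 / 3840) =
    1 + -(t ^ 2 / 2) + (t ^ 2 / 2) ^ 2 / 2 + (-(t ^ 2 / 2)) ^ 3 / 6 + (t ^ 2 / 2) ^ 4 / 24 +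
      (-(t ^ 2 / 2)) ^ 5 / 120 := by ring
  rw [e]
  -- The remainder constant is `7 / 276480`, just below `1 / 39497`.
  refine h.trans ?_
  have : 0 ≤ t ^ 12 := by positivity
  have e2 : (t ^ 2 / 2) ^ 6 * (7 / 4320) = t ^ 12 * (7 / 276480) := by ring
  rw [e2]
  linarith

theorem integral_poly (a c : ℝ) :
    ∫ t in a..0, (1 - t ^ 2 / 2 + t ^ 4 / 8 - t ^ 6 / 48 + t ^ 8 / 384 - t ^ 10 / 3840 +
      c * t ^ 12) =
    -(a - a ^ 3 / 6 + a ^ 5 / 40 - a ^ 7 / 336 + a ^ 9 / 3456 - a ^ 11 / 42240 +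
      c * (a ^ 13 / 13)) := by
  have hd : ∀ t : ℝ, HasDerivAt (fun t => t - t ^ 3 / 6 + t ^ 5 / 40 - t ^ 7 / 336 +
      t ^ 9 / 3456 - t ^ 11 / 42240 + c * (t ^ 13 / 13))
      (1 - t ^ 2 / 2 + t ^ 4 / 8 - t ^ 6 / 48 + t ^ 8 / 384 - t ^ 10 / 3840 + c * t ^ 12) t := by
    intro t
    refine HasDerivAt.congr_deriv
      (((((((hasDerivAt_id t).sub ((hasDerivAt_pow 3 t).div_const 6)).add
        ((hasDerivAt_pow 5 t).div_const 40)).sub ((hasDerivAt_pow 7 t).div_const 336)).add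
        ((hasDerivAt_pow 9 t).div_const 3456)).sub ((hasDerivAt_pow 11 t).div_const 42240)).add
        (((hasDerivAt_pow 13 t).div_const 13).const_mul c)) ?_
    push_cast
    ring
  rw [intervalIntegral.integral_eq_sub_of_hasDerivAt (fun t _ => hd t)
    (Continuous.intervalIntegrable (by fun_prop) _ _)]
  ring

theorem integral_exp_neg_sq_bounds :
    0.7508496 < ∫ t in (-0.84 : ℝ)..0, Real.exp (-(t ^ 2 / 2)) ∧
    ∫ t in (-0.84 : ℝ)..0, Real.exp (-(t ^ 2 / 2)) < 0.7508501 := by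
  have hc : Continuous fun t : ℝ => Real.exp (-(t ^ 2 / 2)) := by fun_prop
  have hsq : ∀ t ∈ Set.Icc (-0.84 : ℝ) 0, t ^ 2 ≤ 1 := fun t ht => by
    nlinarith [ht.1, ht.2]
  have hlo := intervalIntegral.integral_mono_on (μ := volume) (a := -0.84) (b := 0) (by norm_num)
    (f := fun t : ℝ => 1 - t ^ 2 / 2 + t ^ 4 / 8 - t ^ 6 / 48 + t ^ 8 / 384 -
      t ^ 10 / 3840 + (-1 / 39497) * t ^ 12) (g := fun t : ℝ => Real.exp (-(t ^ 2 / 2)))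
    (Continuous.intervalIntegrable (by fun_prop) _ _) (hc.intervalIntegrable _ _)
    (fun t ht => by linarith [(abs_le.1 (abs_exp_neg_sq_sub_le (hsq t ht))).1])
  have hhi := intervalIntegral.integral_mono_on (μ := volume) (a := -0.84) (b := 0) (by norm_num)
    (g := fun t : ℝ => 1 - t ^ 2 / 2 + t ^ 4 / 8 - t ^ 6 / 48 + t ^ 8 / 384 -
      t ^ 10 / 3840 + (1 / 39497) * t ^ 12) (f := fun t : ℝ => Real.exp (-(t ^ 2 / 2)))
    (hc.intervalIntegrable _ _) (Continuous.intervalIntegrable (by fun_prop) _ _)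
    (fun t ht => by linarith [(abs_le.1 (abs_exp_neg_sq_sub_le (hsq t ht))).2])
  rw [integral_poly] at hlo hhi
  refine ⟨lt_of_lt_of_le ?_ hlo, lt_of_le_of_lt hhi ?_⟩ <;> norm_num

theorem exp_bounds : 1.423046 < Real.exp (0.84 ^ 2 / 2) ∧ Real.exp (0.84 ^ 2 / 2) < 1.423047 := by
  have h := abs_le.1 (Real.exp_bound (x := 0.84 ^ 2 / 2) (by norm_num [abs_of_nonneg]) (n := 8)
    (by norm_num))
  simp only [Finset.sum_range_succ, Finset.sum_range_zero, Nat.factorial] at h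
  rw [abs_of_nonneg (by norm_num)] at h
  norm_num at h ⊢
  constructor <;> linarith [h.1, h.2]

/-- `0.84` is slightly above the boundary constant α, and `0.84 * √2500 = 42` is an integer, so this
one number also starts the computation. -/
theorem gaussMoment_bounds : 2.85201 < gaussMoment 0 0.84 1 ∧ gaussMoment 0 0.84 1 < 2.85203 := by
  rw [gaussMoment_eq_integral]
  obtain ⟨h1, h2⟩ := sqrt_pi_div_two_bounds
  obtain ⟨h3, h4⟩ := integral_exp_neg_sq_bounds
  obtain ⟨h5, h6⟩ := exp_bounds
  constructor
  · refine lt_of_lt_of_le ?_ (mul_le_mul h5.le (add_le_add h3.le h1.le) (by norm_num)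
      (by positivity))
    norm_num
  · refine lt_of_le_of_lt (mul_le_mul h6.le (add_le_add h4.le h2.le) (by linarith)
      (by norm_num)) ?_
    norm_num

/-! ### The superharmonic upper bound. -/

/-- A fair flip multiplies each weight by a factor depending on `l` alone. That it is at most `1`
gives superharmonicity; its lower bound controls the failure of harmonicity. -/
theorem average_weight (x n l : ℝ) :
    (Real.exp (l * (x + 1) - l ^ 2 * (n + 1) / 2) +
      Real.exp (l * (x - 1) - l ^ 2 * (n + 1) / 2)) / 2 =
    Real.cosh l * Real.exp (-(l ^ 2 / 2)) * Real.exp (l * x - l ^ 2 * n / 2) := by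
  have e1 : l * (x + 1) - l ^ 2 * (n + 1) / 2 = l + -(l ^ 2 / 2) + (l * x - l ^ 2 * n / 2) := by
    ring
  have e2 : l * (x - 1) - l ^ 2 * (n + 1) / 2 = -l + -(l ^ 2 / 2) + (l * x - l ^ 2 * n / 2) := by
    ring
  rw [e1, e2, Real.cosh_eq]
  simp only [Real.exp_add]
  ring

theorem average_gaussMoment (x : ℝ) {n : ℝ} (hn : 0 < n) :
    IntegrableOn (fun l => Real.cosh l * Real.exp (-(l ^ 2 / 2)) *
      Real.exp (l * x - l ^ 2 * n / 2)) (Set.Ioi 0) ∧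
    (gaussMoment 0 (x + 1) (n + 1) + gaussMoment 0 (x - 1) (n + 1)) / 2 =
      ∫ l in Set.Ioi (0 : ℝ), Real.cosh l * Real.exp (-(l ^ 2 / 2)) *
        Real.exp (l * x - l ^ 2 * n / 2) := by
  have i1 := integrableOn_gaussMoment 0 (x + 1) (n := n + 1) (by positivity)
  have i2 := integrableOn_gaussMoment 0 (x - 1) (n := n + 1) (by positivity)
  unfold gaussMoment
  simp only [pow_zero, one_mul] at i1 i2 ⊢
  constructor
  · simp only [← average_weight]
    exact (i1.add i2).div_const 2
  · simp only [← average_weight]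
    rw [integral_div, integral_add i1 i2]

theorem average_gaussMoment_le (x : ℝ) {n : ℝ} (hn : 0 < n) :
    (gaussMoment 0 (x + 1) (n + 1) + gaussMoment 0 (x - 1) (n + 1)) / 2 ≤ gaussMoment 0 x n := by
  obtain ⟨hi, he⟩ := average_gaussMoment x hn
  rw [he]
  refine setIntegral_mono_on hi (integrableOn_gaussMoment 0 x hn) measurableSet_Ioi fun l _ => ?_
  gcongr
  rw [pow_zero, Real.exp_neg, ← div_eq_mul_inv, div_le_one (Real.exp_pos _)]
  exact Real.cosh_le_exp_half_sq l

theorem le_average_gaussMoment (x : ℝ) {n : ℝ} (hn : 0 < n) :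
    gaussMoment 0 x n - gaussMoment 4 x n / 12 ≤
      (gaussMoment 0 (x + 1) (n + 1) + gaussMoment 0 (x - 1) (n + 1)) / 2 := by
  obtain ⟨hi, he⟩ := average_gaussMoment x hn
  obtain ⟨hi', he'⟩ := integral_quartic 1 0 0 0 (-1 / 12) x hn
  have : gaussMoment 0 x n - gaussMoment 4 x n / 12 = 1 * gaussMoment 0 x n +
      0 * gaussMoment 1 x n + 0 * gaussMoment 2 x n + 0 * gaussMoment 3 x n +
      -1 / 12 * gaussMoment 4 x n := by ring
  rw [he, this, ← he']
  refine setIntegral_mono_on hi' hi measurableSet_Ioi fun l hl => ?_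
  gcongr
  linarith [one_sub_le_cosh_mul_exp (le_of_lt hl)]

/-- By convexity the tangent at `0.83992 * √n` suffices. Here `0.83992` approximates α, and
`0.2945344` is `1 - 0.83992 ^ 2` rounded up. -/
theorem div_le_gaussMoment (x : ℝ) {n : ℝ} (hn : 0 < n) :
    x / n ≤ 0.2945344 * gaussMoment 0 x n := by
  rcases le_total x 0 with hx | hx
  · exact (div_nonpos_of_nonpos_of_nonneg hx hn.le).trans
      (mul_nonneg (by norm_num) (gaussMoment_nonneg _ _ _))
  set s := √n with hs
  have hs0 : 0 < s := Real.sqrt_pos.2 hn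
  have hsn : s ^ 2 = n := Real.sq_sqrt hn.le
  set A := gaussMoment 0 0.83992 1 with hA
  have hAlow : 2.85173 ≤ A := by
    have h1 := gaussMoment_tangent 0.84 (-0.00008) one_pos
    have h2 := gaussMoment_one 0.84 one_pos
    obtain ⟨h3, h4⟩ := gaussMoment_bounds
    norm_num at h1 h2 h3 h4 hA ⊢
    rw [hA]
    linarith
  have h1 := gaussMoment_tangent (0.83992 * s) (x - 0.83992 * s) hn
  have h2 := gaussMoment_one (0.83992 * s) hn
  have h3 : gaussMoment 0 (0.83992 * s) n = A / s := by
    rw [← hsn]; exact gaussMoment_zero_mul hs0 _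
  rw [add_sub_cancel, h3] at h1
  rw [h3] at h2
  set M := gaussMoment 1 (0.83992 * s) n
  set G := gaussMoment 0 x n
  have e1 : 0.83992 * s * (A / s) = 0.83992 * A := by field_simp
  rw [e1] at h2
  have h4 : n * G ≥ A * s + (x - 0.83992 * s) * (0.83992 * A + 1) := by
    have : n * (A / s + (x - 0.83992 * s) * M) ≤ n * G := by gcongr
    have e2 : n * (A / s) = A * s := by rw [← hsn]; field_simp
    nlinarith
  rw [div_le_iff₀ hn]
  have hG : 0 ≤ n * G := mul_nonneg hn.le (gaussMoment_nonneg _ _ _)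
  -- The part of `h4` free of `x` is `s * ((1 - 0.83992 ^ 2) * A - 0.83992)`, which is nonnegative
  -- by `hAlow`.
  have h5 : x * (0.83992 * A + 1) ≤ n * G := by nlinarith
  have h6 : 1 ≤ 0.2945344 * (0.83992 * A + 1) := by linarith
  nlinarith

/-- An upper bound for the value, from the solution for Brownian motion. -/
theorem diffValue_le_gaussMoment (x : ℤ) {n : ℕ} (hn : 1 ≤ n) :
    diffValue x n ≤ 0.2945344 * gaussMoment 0 x n := by
  refine ciSup_le fun k => horizonValue_le_of_superharmonic
    (F := fun x n => 0.2945344 * gaussMoment 0 x n) (fun x n hn => ?_) (fun x n hn => ?_) k x hn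
  · exact div_le_gaussMoment _ (by exact_mod_cast hn)
  · have := average_gaussMoment_le x (n := n) (by exact_mod_cast hn)
    push_cast
    linarith

/-! ### The lower bound from 2500 flips on. -/

/-- At the boundary `y` the moment recurrences reduce this to `gaussMoment_bounds`. Passing to
smaller `x` tilts the weight towards small `l`, which favours the lower moment. -/
theorem gaussMoment_four_le {x n : ℝ} (hn : 0 < n) (hx : x ≤ 0.84 * √n) :
    n ^ 2 * gaussMoment 4 x n ≤ 12 * gaussMoment 0 x n := by
  set s := √n with hs
  have hs0 : 0 < s := Real.sqrt_pos.2 hn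
  have hsn : s ^ 2 = n := Real.sq_sqrt hn.le
  set y := 0.84 * s with hy
  have hG : gaussMoment 0 y n = gaussMoment 0 0.84 1 / s := by
    rw [← hsn]; exact gaussMoment_zero_mul hs0 _
  have hy4 : 0 ≤ 12 * gaussMoment 0 y n - n ^ 2 * gaussMoment 4 y n := by
    have m1 := gaussMoment_one y hn
    have m2 := gaussMoment_add_two 0 y hn
    have m3 := gaussMoment_add_two 1 y hn
    have m4 := gaussMoment_add_two 2 y hn
    norm_num at m2 m3 m4
    have hGs : s * gaussMoment 0 y n = gaussMoment 0 0.84 1 := by rw [hG]; field_simp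
    have hlow := gaussMoment_bounds.1
    rw [← hGs] at hlow
    have key : n ^ 2 * (n ^ 2 * gaussMoment 4 y n) =
        (y ^ 4 + 6 * y ^ 2 * n + 3 * n ^ 2) * gaussMoment 0 y n + y ^ 3 + 5 * y * n := by
      linear_combination n ^ 3 * m4 + y * n ^ 2 * m3 + (y ^ 2 + 3 * n) * n * m2 +
        (y ^ 3 + 5 * y * n) * m1
    have key2 : n ^ 2 * (12 * gaussMoment 0 y n - n ^ 2 * gaussMoment 4 y n) =
        s ^ 3 * ((9 - 0.84 ^ 4 - 6 * 0.84 ^ 2) * (s * gaussMoment 0 y n)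
          - 0.84 ^ 3 - 5 * 0.84) := by
      rw [mul_sub, key, hy, ← hsn]; ring
    have : 0 ≤ n ^ 2 * (12 * gaussMoment 0 y n - n ^ 2 * gaussMoment 4 y n) := by
      rw [key2]
      refine mul_nonneg (by positivity) ?_
      norm_num at hlow ⊢
      linarith
    exact nonneg_of_mul_nonneg_right this (by positivity)
  -- `r` is the only sign change of `12 - n ^ 2 * l ^ 4` on the half-line, and `exp (l * (x - y))`
  -- is decreasing in `l`. Replacing this factor by its value at `r` therefore lowers the integrand
  -- on both sides.
  obtain ⟨r, hr0, hr⟩ : ∃ r : ℝ, 0 ≤ r ∧ n ^ 2 * r ^ 4 = 12 := by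
    refine ⟨√√(12 / n ^ 2), by positivity, ?_⟩
    have : √√(12 / n ^ 2) ^ 4 = 12 / n ^ 2 := by
      rw [show (4 : ℕ) = 2 * 2 from rfl, pow_mul, Real.sq_sqrt (by positivity),
        Real.sq_sqrt (by positivity)]
    rw [this]
    field_simp
  obtain ⟨hi, he⟩ := integral_quartic 12 0 0 0 (-n ^ 2) x hn
  obtain ⟨hi', he'⟩ := integral_quartic 12 0 0 0 (-n ^ 2) y hn
  have hcmp : Real.exp (r * (x - y)) * ∫ l in Set.Ioi (0 : ℝ),
      (12 + 0 * l + 0 * l ^ 2 + 0 * l ^ 3 + -n ^ 2 * l ^ 4) * Real.exp (l * y - l ^ 2 * n / 2) ≤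
      ∫ l in Set.Ioi (0 : ℝ),
      (12 + 0 * l + 0 * l ^ 2 + 0 * l ^ 3 + -n ^ 2 * l ^ 4) *
        Real.exp (l * x - l ^ 2 * n / 2) := by
    rw [← integral_const_mul]
    refine setIntegral_mono_on (hi'.const_mul _) hi measurableSet_Ioi fun l hl => ?_
    have hl0 : (0 : ℝ) < l := hl
    have e : Real.exp (l * x - l ^ 2 * n / 2) =
        Real.exp (l * (x - y)) * Real.exp (l * y - l ^ 2 * n / 2) := by
      rw [← Real.exp_add]; congr 1; ring
    rw [e]
    have hW := Real.exp_pos (l * y - l ^ 2 * n / 2)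
    have hp : 12 + 0 * l + 0 * l ^ 2 + 0 * l ^ 3 + -n ^ 2 * l ^ 4 = n ^ 2 * (r ^ 4 - l ^ 4) := by
      linarith
    rw [hp]
    have : 0 ≤ (r ^ 4 - l ^ 4) * (Real.exp (l * (x - y)) - Real.exp (r * (x - y))) := by
      rcases le_total l r with h | h
      · refine mul_nonneg (sub_nonneg.2 (by gcongr)) (sub_nonneg.2 (Real.exp_le_exp.2 ?_))
        nlinarith
      · refine mul_nonneg_of_nonpos_of_nonpos (sub_nonpos.2 (by gcongr))
          (sub_nonpos.2 (Real.exp_le_exp.2 ?_))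
        nlinarith
    have h2 := mul_nonneg (mul_nonneg (sq_nonneg n) this) hW.le
    nlinarith
  rw [he, he'] at hcmp
  have : 0 ≤ Real.exp (r * (x - y)) * (12 * gaussMoment 0 y n + 0 * gaussMoment 1 y n +
      0 * gaussMoment 2 y n + 0 * gaussMoment 3 y n + -n ^ 2 * gaussMoment 4 y n) :=
    mul_nonneg (Real.exp_pos _).le (by linarith)
  linarith

/-- The lower bound for the value in the continuation region. -/
noncomputable def lowerValue (x n : ℝ) : ℝ := 0.29452 * (1 - 1.1 / n) * gaussMoment 0 x n

/-- A flip loses at most `gaussMoment 4 / 12`, hence at most the fraction `1 / n ^ 2` of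
`gaussMoment 0`. The factor `1 - 1.1 / n` grows by `1.1 / (n * (n + 1))`, which is more than enough.
-/
theorem lowerValue_le_average {x n : ℝ} (hn : 2500 ≤ n) (hx : x ≤ 0.84 * √n) :
    lowerValue x n ≤ (lowerValue (x + 1) (n + 1) + lowerValue (x - 1) (n + 1)) / 2 := by
  have hn0 : 0 < n := by linarith
  have h1 := le_average_gaussMoment x hn0
  have h2 := gaussMoment_four_le hn0 hx
  have hG := gaussMoment_nonneg 0 x n
  set A := (gaussMoment 0 (x + 1) (n + 1) + gaussMoment 0 (x - 1) (n + 1)) / 2 with hA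
  have e : (lowerValue (x + 1) (n + 1) + lowerValue (x - 1) (n + 1)) / 2 =
      0.29452 * ((1 - 1.1 / (n + 1)) * A) := by
    simp only [lowerValue, hA]; ring
  rw [e]
  unfold lowerValue
  rw [mul_assoc]
  refine mul_le_mul_of_nonneg_left ?_ (by norm_num)
  have h3 : (1 - 1 / n ^ 2) * gaussMoment 0 x n ≤ A := by
    have : gaussMoment 4 x n / 12 ≤ 1 / n ^ 2 * gaussMoment 0 x n := by
      rw [div_mul_eq_mul_div, one_mul, div_le_div_iff₀ (by norm_num) (by positivity)]
      linarith
    linarith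
  have h4 : 0 ≤ 1 - 1.1 / (n + 1) := by
    rw [sub_nonneg, div_le_one (by positivity)]
    norm_num
    linarith
  have h5 : (1 - 1.1 / n) ≤ (1 - 1.1 / (n + 1)) * (1 - 1 / n ^ 2) := by
    have : (1 - 1.1 / (n + 1)) * (1 - 1 / n ^ 2) - (1 - 1.1 / n) =
        (0.1 * n - 1 + 1.1 / n * n) / (n ^ 2 * (n + 1)) + 0 := by
      field_simp
      ring
    have h6 : 0 ≤ (0.1 * n - 1 + 1.1 / n * n) / (n ^ 2 * (n + 1)) := by
      apply div_nonneg _ (by positivity)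
      have : 1.1 / n * n = 1.1 := by field_simp
      rw [this]
      norm_num
      linarith
    linarith
  calc (1 - 1.1 / n) * gaussMoment 0 x n
      ≤ (1 - 1.1 / (n + 1)) * (1 - 1 / n ^ 2) * gaussMoment 0 x n := by gcongr
    _ = (1 - 1.1 / (n + 1)) * ((1 - 1 / n ^ 2) * gaussMoment 0 x n) := by ring
    _ ≤ _ := by gcongr

/-- A step up from below the boundary overshoots it by at most one. As the Brownian value is tangent
to the payoff, the relative excess at overshoot `h = η * √n` is about `η ^ 2 ≤ 1 / n`, and the
factor `1 - 1.1 / n` absorbs it. The proof expands back to `0.84 * √n` and eliminates the moments.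
-/
theorem lowerValue_le_div {x n : ℝ} (hn : 2500 ≤ n) (hx : 0.84 * √n ≤ x)
    (hx' : x ≤ 0.84 * √n + 1) : lowerValue x n ≤ x / n := by
  have hn0 : 0 < n := by linarith
  set s := √n with hs
  have hs50 : 50 ≤ s := by
    rw [hs]; exact Real.le_sqrt_of_sq_le (by norm_num; linarith)
  have hs0 : 0 < s := by linarith
  have hsn : s ^ 2 = n := Real.sq_sqrt hn0.le
  obtain ⟨h, rfl⟩ : ∃ h, x = 0.84 * s + h := ⟨x - 0.84 * s, by ring⟩
  have hh0 : 0 ≤ h := by linarith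
  have hh1 : h ≤ 1 := by linarith
  set y := 0.84 * s + h with hy
  have hT := gaussMoment_ge_of_quartic (a₀ := 1) (a₁ := -h) (a₂ := h ^ 2 / 2) (a₃ := -h ^ 3 / 6)
    (a₄ := 0) (h := -h) (fun l hl => by
      have := cubic_le_exp_neg (t := l * h) (by positivity)
      rw [mul_neg]
      linarith) y hn0
  have m1 := gaussMoment_one y hn0
  have m2 := gaussMoment_add_two 0 y hn0
  have m3 := gaussMoment_add_two 1 y hn0
  norm_num at m2 m3
  have hx1 : gaussMoment 0 (y + -h) n = gaussMoment 0 0.84 1 / s := by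
    rw [← hsn, hy, add_neg_cancel_right]; exact gaussMoment_zero_mul hs0 _
  rw [hx1] at hT
  obtain ⟨η, hη⟩ : ∃ η, h = η * s := ⟨h / s, by field_simp⟩
  have hη0 : 0 ≤ η := by
    by_contra hc
    nlinarith
  have hηs : η * s ≤ 1 := hη ▸ hh1
  have hη1 : η ≤ 0.02 := by
    by_contra hc
    push Not at hc
    nlinarith
  set G := gaussMoment 0 y n with hG
  have hG0 : 0 ≤ G := gaussMoment_nonneg _ _ _
  set g := s * G with hg
  have hg0 : 0 ≤ g := by positivity
  have hyz : y = (0.84 + η) * s := by rw [hy, hη]; ring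
  set ζ := 0.84 + η with hζ
  rw [hyz, ← hsn] at m1 m2 m3
  rw [← hsn] at hT
  have p1 : s ^ 2 * gaussMoment 1 y (s ^ 2) = ζ * g + 1 := by
    rw [hyz, m1, hg]; ring
  have p2 : s ^ 3 * gaussMoment 2 y (s ^ 2) = ζ * (ζ * g + 1) + g := by
    rw [← p1, hg, hyz]; linear_combination s * m2
  have p3 : s ^ 4 * gaussMoment 3 y (s ^ 2) =
      ζ * (ζ * (ζ * g + 1) + g) + 2 * (ζ * g + 1) := by
    rw [← p2, ← p1, hyz]; linear_combination s ^ 2 * m3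
  have hψ : gaussMoment 0 0.84 1 ≥ g - η * (ζ * g + 1) + η ^ 2 / 2 * (ζ * (ζ * g + 1) + g) -
      η ^ 3 / 6 * (ζ * (ζ * (ζ * g + 1) + g) + 2 * (ζ * g + 1)) := by
    have hT' := mul_le_mul_of_nonneg_left hT hs0.le
    rw [mul_div_cancel₀ _ hs0.ne'] at hT'
    rw [← p3, ← p2, ← p1]
    rw [hη] at hT'
    rw [hg]
    linarith
  have hup := gaussMoment_bounds.2
  set A := 1 - η * ζ + η ^ 2 / 2 * (ζ ^ 2 + 1) - η ^ 3 / 6 * (ζ ^ 3 + 3 * ζ) with hA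
  set B := η - η ^ 2 / 2 * ζ + η ^ 3 / 6 * (ζ ^ 2 + 2) with hB
  have hAB : g * A ≤ 2.85203 + B := by
    rw [hA, hB]; linarith
  have hA0 : 0 < A := by
    have h1 : η * ζ ≤ 0.02 * 0.86 := by gcongr; linarith
    have h2 : η ^ 3 / 6 * (ζ ^ 3 + 3 * ζ) ≤ 0.02 ^ 3 / 6 * (0.86 ^ 3 + 3 * 0.86) := by
      have : ζ ≤ 0.86 := by linarith
      gcongr
    have h3 : 0 ≤ η ^ 2 / 2 * (ζ ^ 2 + 1) := by positivity
    rw [hA]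
    norm_num at h1 h2 ⊢
    linarith
  have hpoly : 0.29452 * (1 - 1.1 * η ^ 2) * (2.85203 + B) ≤ ζ * A := by
    have h4 : η ^ 4 ≤ 0.02 * η ^ 3 := by
      rw [pow_succ η 3, mul_comm]; gcongr
    have h5 : η ^ 5 ≤ 0.02 * η ^ 3 := by
      have : η ^ 5 ≤ 1 * η ^ 4 := by
        rw [pow_succ η 4, mul_comm]; gcongr; linarith
      linarith
    have h6 : η ^ 6 ≤ 0.02 * η ^ 3 := by
      have : η ^ 6 ≤ 1 * η ^ 5 := by
        rw [pow_succ η 5, mul_comm]; gcongr; linarith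
      linarith
    have h7 : η ^ 7 ≤ 0.02 * η ^ 3 := by
      have : η ^ 7 ≤ 1 * η ^ 6 := by
        rw [pow_succ η 6, mul_comm]; gcongr; linarith
      linarith
    have h3 : 0 ≤ η ^ 3 := by positivity
    have h2 : 0 ≤ η ^ 2 := by positivity
    rw [← sub_nonneg]
    rw [hA, hB, hζ]
    ring_nf
    norm_num at h4 h5 h6 h7 hη1 ⊢
    linarith
  have hη2 : η ^ 2 ≤ 1 / s ^ 2 := by
    rw [le_div_iff₀ (by positivity), ← mul_pow]
    exact pow_le_one₀ (by positivity) hηs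
  have hfin : 0.29452 * (1 - 1.1 / s ^ 2) * g ≤ ζ := by
    have h1 : 0.29452 * (1 - 1.1 / s ^ 2) ≤ 0.29452 * (1 - 1.1 * η ^ 2) := by
      have : 1.1 / s ^ 2 = 1.1 * (1 / s ^ 2) := by ring
      rw [this]
      gcongr
    have h2 : 0 ≤ 1 - 1.1 * η ^ 2 := by
      have : η ^ 2 ≤ 0.02 ^ 2 := by gcongr
      norm_num at this ⊢
      linarith
    have h3 : 0.29452 * (1 - 1.1 / s ^ 2) * g * A ≤ ζ * A :=
      calc 0.29452 * (1 - 1.1 / s ^ 2) * g * A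
          ≤ 0.29452 * (1 - 1.1 * η ^ 2) * g * A := by gcongr
        _ = 0.29452 * (1 - 1.1 * η ^ 2) * (g * A) := by ring
        _ ≤ 0.29452 * (1 - 1.1 * η ^ 2) * (2.85203 + B) := by gcongr
        _ ≤ _ := hpoly
    exact le_of_mul_le_mul_right h3 hA0
  unfold lowerValue
  rw [← hG, hyz, ← hsn, sq s, mul_div_mul_right _ _ hs0.ne', le_div_iff₀ hs0, ← sq s]
  linarith

open Classical in
/-- `lowerValue` below the stopping boundary, the payoff above it. -/
noncomputable def lowerBarrier (x : ℤ) (n : ℕ) : ℝ :=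
  if (x : ℝ) < 0.84 * √n then lowerValue x n else (x : ℝ) / n

theorem lowerBarrier_of_lt {x : ℤ} {n : ℕ} (h : (x : ℝ) < 0.84 * √n) :
    lowerBarrier x n = lowerValue x n := if_pos h

theorem lowerBarrier_of_le {x : ℤ} {n : ℕ} (h : 0.84 * √n ≤ (x : ℝ)) :
    lowerBarrier x n = (x : ℝ) / n := if_neg (not_lt.2 h)

theorem lowerValue_le_lowerBarrier {x : ℤ} {n : ℕ} (hn : 2500 ≤ n)
    (hx : (x : ℝ) ≤ 0.84 * √n + 1) : lowerValue x n ≤ lowerBarrier x n := by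
  rcases lt_or_ge (x : ℝ) (0.84 * √n) with h | h
  · rw [lowerBarrier_of_lt h]
  · rw [lowerBarrier_of_le h]
    exact lowerValue_le_div (by exact_mod_cast hn) h hx

theorem lowerBarrier_le (x : ℤ) {n : ℕ} (hn : 2500 ≤ n) :
    lowerBarrier x n ≤ (x : ℝ) / n ∨
      lowerBarrier x n ≤ (lowerBarrier (x + 1) (n + 1) + lowerBarrier (x - 1) (n + 1)) / 2 := by
  rcases lt_or_ge (x : ℝ) (0.84 * √n) with h | h
  · right
    rw [lowerBarrier_of_lt h]
    have hs : √(n : ℝ) ≤ √((n + 1 : ℕ) : ℝ) := Real.sqrt_le_sqrt (by push_cast; linarith)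
    have h1 := lowerValue_le_lowerBarrier (x := x + 1) (n := n + 1) (by omega)
      (by push_cast at hs ⊢; linarith)
    have h2 := lowerValue_le_lowerBarrier (x := x - 1) (n := n + 1) (by omega)
      (by push_cast at hs ⊢; linarith)
    have h3 := lowerValue_le_average (n := n) (by exact_mod_cast hn) h.le
    push_cast at h1 h2
    linarith
  · left
    rw [lowerBarrier_of_le h]

theorem lowerValue_le_inv_sqrt {x n : ℝ} (hn : 2500 ≤ n) (hx : x ≤ 0.84 * √n) :
    lowerValue x n ≤ 1 / √n := by
  have hn0 : 0 < n := by linarith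
  have hs0 : 0 < √n := Real.sqrt_pos.2 hn0
  have hsn : √n ^ 2 = n := Real.sq_sqrt hn0.le
  have h1 := gaussMoment_mono_left 0 hx hn0
  have h2 : gaussMoment 0 (0.84 * √n) n = gaussMoment 0 0.84 1 / √n := by
    have := gaussMoment_zero_mul hs0 0.84
    rwa [hsn] at this
  have h3 := gaussMoment_bounds.2
  have h4 : 1.1 / n ≤ 1 := by rw [div_le_one hn0]; norm_num; linarith
  have h5 : 0 ≤ 1.1 / n := by positivity
  unfold lowerValue
  calc 0.29452 * (1 - 1.1 / n) * gaussMoment 0 x n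
      ≤ 0.29452 * (1 - 0) * (2.85203 / √n) := by
        rw [h2] at h1
        have h6 : gaussMoment 0 x n ≤ 2.85203 / √n := h1.trans (by gcongr)
        gcongr
        exact gaussMoment_nonneg _ _ _
    _ ≤ 1 / √n := by
        rw [← mul_div_assoc]
        gcongr
        norm_num

/-- The lower bound for the value in the continuation region. -/
theorem lowerValue_le_diffValue {x : ℤ} {n : ℕ} (hn : 2500 ≤ n) (hx : (x : ℝ) < 0.84 * √n) :
    lowerValue x n ≤ diffValue x n := by
  have key : ∀ K : ℕ, n ≤ K → lowerBarrier x n - (4 + (x : ℝ) ^ 2) / (2 * √K) ≤ diffValue x n := by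
    intro K hK
    have hK0 : (0 : ℝ) < K := by exact_mod_cast (by omega : 0 < K)
    have hs0 : 0 < √(K : ℝ) := Real.sqrt_pos.2 hK0
    have hsK : √(K : ℝ) ^ 2 = K := Real.sq_sqrt hK0.le
    -- `x ^ 2 - n` is harmonic for the walk, so `E` is a martingale. At time `K` it covers the gap
    -- `1 / √K - y / K`, since the difference is a square; at a fixed position it tends to `0` as
    -- `K` grows.
    set E : ℤ → ℕ → ℝ := fun x n => (3 + ((x : ℝ) ^ 2 + K - n) / K) / (2 * √K) with hE
    obtain ⟨k, rfl⟩ := Nat.exists_eq_add_of_le hK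
    have h := sub_le_horizonValue (L := lowerBarrier) (E := E) (N := 2500) (K := n + k)
      (fun x n hn => lowerBarrier_le x hn)
      (fun x m hm => by
        have : (m : ℝ) ≤ (n + k : ℕ) := by exact_mod_cast hm
        have : 0 ≤ (x : ℝ) ^ 2 + (n + k : ℕ) - m := by nlinarith [sq_nonneg (x : ℝ)]
        simp only [hE]
        positivity)
      (fun x m _ => by
        simp only [hE]
        push_cast
        apply le_of_eq
        field_simp
        ring)
      (fun y => by
        have hE0 : 0 ≤ E y (n + k) := by
          simp only [hE, add_sub_cancel_right]
          positivity
        rcases lt_or_ge (y : ℝ) (0.84 * √(n + k : ℕ)) with h | h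
        · rw [lowerBarrier_of_lt h]
          have h1 := lowerValue_le_inv_sqrt (n := (n + k : ℕ))
            (by exact_mod_cast (by omega : 2500 ≤ n + k)) h.le
          simp only [hE, add_sub_cancel_right]
          set s := √((n + k : ℕ) : ℝ) with hs
          rw [← hsK]
          have h2 : 1 / s - (3 + (y : ℝ) ^ 2 / s ^ 2) / (2 * s) - y / s ^ 2 =
              -((s + y) ^ 2) / (2 * s ^ 3) := by
            field_simp
            ring
          have h3 : -((s + y) ^ 2) / (2 * s ^ 3) ≤ 0 :=
            div_nonpos_of_nonpos_of_nonneg (by nlinarith [sq_nonneg (s + y)]) (by positivity)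
          rw [← hsK] at h1
          linarith
        · rw [lowerBarrier_of_le h]
          linarith)
      k x hn rfl
    have hEx : E x n ≤ (4 + (x : ℝ) ^ 2) / (2 * √(n + k : ℕ)) := by
      refine div_le_div_of_nonneg_right ?_ (by positivity)
      have hK1 : (1 : ℝ) ≤ (n + k : ℕ) := by exact_mod_cast (by omega : 1 ≤ n + k)
      have : ((x : ℝ) ^ 2 + (n + k : ℕ) - n) / (n + k : ℕ) ≤ 1 + (x : ℝ) ^ 2 := by
        rw [div_le_iff₀ hK0]
        have : (0 : ℝ) ≤ n := by positivity
        nlinarith [sq_nonneg (x : ℝ)]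
      linarith
    have h2 := horizonValue_le_diffValue k x (n := n) (by omega)
    linarith
  rw [← lowerBarrier_of_lt hx]
  have hlim : Filter.Tendsto (fun K : ℕ => lowerBarrier x n - (4 + (x : ℝ) ^ 2) / (2 * √K))
      Filter.atTop (nhds (lowerBarrier x n - 0)) := by
    refine tendsto_const_nhds.sub (Filter.Tendsto.const_div_atTop ?_ _)
    exact (Real.tendsto_sqrt_atTop.comp tendsto_natCast_atTop_atTop).const_mul_atTop two_pos
  rw [sub_zero] at hlim
  exact le_of_tendsto hlim (Filter.eventually_atTop.2 ⟨n, key⟩)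

/-- Far out, continuing is better at difference at most `26`. -/
theorem div_lt_diffValue_of_le_26 {x : ℤ} (hx : x ≤ 26) {n : ℕ} (hn : 2500 ≤ n) :
    (x : ℝ) / n < diffValue x n := by
  refine div_lt_diffValue_of_le hx (by omega) ?_
  have hn' : (2500 : ℝ) ≤ n := by exact_mod_cast hn
  have hn0 : (0 : ℝ) < n := by linarith
  set s := √(n : ℝ) with hs
  have hs50 : 50 ≤ s := by
    rw [hs]; exact Real.le_sqrt_of_sq_le (by norm_num; linarith)
  have hs0 : 0 < s := by linarith
  have hsn : s ^ 2 = n := Real.sq_sqrt hn0.le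
  refine lt_of_lt_of_le ?_ (lowerValue_le_diffValue hn (by push_cast; rw [← hs]; linarith))
  have h1 := gaussMoment_tangent 0 26 hn0
  have h2 := gaussMoment_one 0 hn0
  have h3 : gaussMoment 0 0 (n : ℝ) = √(Real.pi / 2) / s := by
    rw [← gaussMoment_zero_zero, ← hsn]
    simpa using gaussMoment_zero_mul hs0 0
  have h4 := sqrt_pi_div_two_bounds.1
  have h5 : gaussMoment 1 0 (n : ℝ) = 1 / n := by
    rw [eq_div_iff hn0.ne']; linarith
  rw [h3, h5, zero_add] at h1
  -- `88.66` is `50 * √(π / 2) + 26` rounded down; multiplied by `0.29452 * (1 - 1.1 / 2500)` it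
  -- still exceeds `26`.
  have h6 : (88.66 : ℝ) / n ≤ gaussMoment 0 26 n := by
    refine le_trans ?_ h1
    have e : √(Real.pi / 2) / s + 26 * (1 / n) = (√(Real.pi / 2) * s + 26) / n := by
      rw [← hsn]; field_simp
    rw [e]
    gcongr
    nlinarith
  unfold lowerValue
  push_cast
  have h7 : 1.1 / (n : ℝ) ≤ 1.1 / 2500 := by gcongr
  calc (26 : ℝ) / n < 0.29452 * (1 - 1.1 / 2500) * (88.66 / n) := by
        rw [← mul_div_assoc]
        gcongr
        norm_num
    _ ≤ 0.29452 * (1 - 1.1 / n) * gaussMoment 0 26 n := by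
        gcongr
        norm_num at h7 ⊢
        linarith

/-! ### Integer bounds after 2500 flips and their backward step. -/

/-- The cubic Taylor bound for `exp (-2 l)`, with higher moments eliminated and denominators
cleared. It carries a lower bound from `x` to `x - 2`, the next difference of the same parity. -/
theorem gaussMoment_sub_two_ge (x : ℝ) {n : ℝ} (hn : 0 < n) :
    (3 * n ^ 3 - 6 * x * n ^ 2 + 6 * (x ^ 2 + n) * n - 4 * (x ^ 3 + 3 * x * n)) *
        gaussMoment 0 x n + (-6 * n ^ 2 + 6 * x * n - 4 * (x ^ 2 + 2 * n)) ≤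
      3 * n ^ 3 * gaussMoment 0 (x - 2) n := by
  have h := gaussMoment_ge_of_quartic (a₀ := 1) (a₁ := -2) (a₂ := 2) (a₃ := -4 / 3) (a₄ := 0)
    (h := -2) (fun l hl => by
      have := cubic_le_exp_neg (t := l * 2) (by positivity)
      rw [mul_neg]
      linarith) x hn
  have m1 := gaussMoment_one x hn
  have m2 := gaussMoment_add_two 0 x hn
  have m3 := gaussMoment_add_two 1 x hn
  norm_num at m2 m3
  have h' := mul_le_mul_of_nonneg_left h (show 0 ≤ 3 * n ^ 3 by positivity)
  rw [← sub_eq_add_neg] at h'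
  refine le_of_eq_of_le ?_ h'
  linear_combination (6 * n ^ 2 - 6 * x * n + 4 * x ^ 2 + 8 * n) * m1 +
    (-6 * n ^ 2 + 4 * x * n) * m2 + 4 * n ^ 2 * m3

theorem gaussMoment_sub_two_le (x : ℝ) {n : ℝ} (hn : 0 < n) :
    3 * n ^ 4 * gaussMoment 0 (x - 2) n ≤
      (3 * n ^ 4 - 6 * x * n ^ 3 + 6 * (x ^ 2 + n) * n ^ 2 - 4 * (x ^ 3 + 3 * x * n) * n +
        2 * (x ^ 4 + 6 * x ^ 2 * n + 3 * n ^ 2)) * gaussMoment 0 x n +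
      (-6 * n ^ 3 + 6 * x * n ^ 2 - 4 * (x ^ 2 + 2 * n) * n + 2 * (x ^ 3 + 5 * x * n)) := by
  have h := gaussMoment_le_of_quartic (a₀ := 1) (a₁ := -2) (a₂ := 2) (a₃ := -4 / 3) (a₄ := 2 / 3)
    (h := -2) (fun l hl => by
      have := exp_neg_le_quartic (t := l * 2) (by positivity)
      rw [mul_neg]
      linarith) x hn
  have m1 := gaussMoment_one x hn
  have m2 := gaussMoment_add_two 0 x hn
  have m3 := gaussMoment_add_two 1 x hn
  have m4 := gaussMoment_add_two 2 x hn
  norm_num at m2 m3 m4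
  have h' := mul_le_mul_of_nonneg_left h (show 0 ≤ 3 * n ^ 4 by positivity)
  rw [← sub_eq_add_neg] at h'
  refine le_of_le_of_eq h' ?_
  linear_combination (-6 * n ^ 3 + 6 * x * n ^ 2 - 4 * x ^ 2 * n - 8 * n ^ 2 +
      2 * (x ^ 3 + 5 * x * n)) * m1 +
    (6 * n ^ 3 - 4 * x * n ^ 2 + 2 * (x ^ 2 + 3 * n) * n) * m2 + (-4 * n ^ 3 + 2 * x * n ^ 2) * m3 +
    2 * n ^ 3 * m4

/-- Known from 2500 flips on and passed to smaller `n` by averaging. It allows `0` as the neighbour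
missing at the lower end of a row. -/
theorem diffValue_nonneg (x : ℤ) {n : ℕ} (hn : 1 ≤ n) : 0 ≤ diffValue x n := by
  have hfar : ∀ n : ℕ, 2500 ≤ n → ∀ x, 0 ≤ diffValue x n := by
    intro n hn x
    have hn' : (2500 : ℝ) ≤ n := by exact_mod_cast hn
    rcases le_or_gt 0 x with hx | hx
    · refine le_trans ?_ (div_le_diffValue x (by omega))
      have : (0 : ℝ) ≤ x := by exact_mod_cast hx
      positivity
    · refine le_trans ?_ (lowerValue_le_diffValue (x := x) hn ?_)
      · unfold lowerValue
        have : 1.1 / (n : ℝ) ≤ 1 := by rw [div_le_one (by linarith)]; norm_num; linarith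
        exact mul_nonneg (mul_nonneg (by norm_num) (by linarith)) (gaussMoment_nonneg _ _ _)
      · have : (x : ℝ) < 0 := by exact_mod_cast hx
        have : 0 ≤ 0.84 * √(n : ℝ) := by positivity
        linarith
  rcases le_total 2500 n with h | h
  · exact hfar n h x
  · induction h using Nat.decreasingInduction generalizing x with
    | self => exact hfar _ le_rfl x
    | of_succ k hk ih =>
      refine le_trans ?_ (average_le_diffValue x hn)
      linarith [ih (x + 1) (by omega), ih (x - 1) (by omega)]

/-- Evaluates the argument before it is passed on. -/
noncomputable def force {α : Type} (n : ℕ) (f : ℕ → α) : α :=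
  Nat.rec (motive := fun _ => α) (f 0) (fun m _ => f (m + 1)) n

theorem force_eq {α : Type} (n : ℕ) (f : ℕ → α) : force n f = f n := by
  cases n <;> rfl

/-- The scale of the fixed point arithmetic, `2 ^ 46`. -/
def scale : ℕ := 70368744177664

/-- Entry `i` of the row is a scaled lower bound for the value at difference `x - 2 i`. -/
def LowerRow (n : ℕ) : ℤ → List ℕ → Prop
  | _, [] => True
  | x, a :: l => (a : ℝ) ≤ scale * diffValue x n ∧ LowerRow n (x - 2) l

/-- Entry `i` of the row is a scaled upper bound for the value at difference `x - 2 i`. -/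
def UpperRow (n : ℕ) : ℤ → List ℕ → Prop
  | _, [] => True
  | x, a :: l => scale * diffValue x n ≤ a ∧ UpperRow n (x - 2) l

/-- Averages of neighbours, rounded down; the last entry is averaged with `0` if `e` holds. -/
noncomputable def averageLower (e : Bool) (l : List ℕ) : ℕ → List ℕ :=
  List.rec (motive := fun _ => ℕ → List ℕ) (fun a => cond e [a / 2] [])
    (fun b _ ih a => force ((a + b) / 2) fun v => v :: ih b) l

/-- The larger of the average of neighbours, rounded up, and the payoff, which is at most
`x * q`; the last entry is averaged with itself if `e` holds. -/
noncomputable def averageUpper (e : Bool) (q : ℕ) (l : List ℕ) : ℕ → ℕ → List ℕ :=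
  List.rec (motive := fun _ => ℕ → ℕ → List ℕ) (fun a x => cond e [max a (x * q)] [])
    (fun b _ ih a x => force (max ((a + b + 1) / 2) (x * q)) fun v => v :: ih b (x - 2)) l

theorem averageLower_nil (e : Bool) (a : ℕ) :
    averageLower e [] a = cond e [a / 2] [] := rfl

theorem averageLower_cons (e : Bool) (b : ℕ) (l : List ℕ) (a : ℕ) :
    averageLower e (b :: l) a = (a + b) / 2 :: averageLower e l b :=
  force_eq ((a + b) / 2) fun v => v :: averageLower e l b

theorem averageUpper_nil (e : Bool) (q a x : ℕ) :
    averageUpper e q [] a x = cond e [max a (x * q)] [] := rfl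

theorem averageUpper_cons (e : Bool) (q b : ℕ) (l : List ℕ) (a x : ℕ) :
    averageUpper e q (b :: l) a x =
      max ((a + b + 1) / 2) (x * q) :: averageUpper e q l b (x - 2) :=
  force_eq (max ((a + b + 1) / 2) (x * q)) fun v => v :: averageUpper e q l b (x - 2)

theorem lowerRow_averageLower {n : ℕ} (hn : 1 ≤ n) (e : Bool) {l : List ℕ} {x : ℤ} {a : ℕ}
    (h : LowerRow (n + 1) (x + 1) (a :: l)) : LowerRow n x (averageLower e l a) := by
  have hhalf : ∀ k : ℕ, ((k / 2 : ℕ) : ℝ) ≤ (k : ℝ) / 2 := fun k => Nat.cast_div_le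
  have hs : (0 : ℝ) < scale := by norm_num [scale]
  induction l generalizing x a with
  | nil =>
    rw [averageLower_nil]
    cases e
    · trivial
    · refine ⟨(hhalf a).trans ?_, trivial⟩
      have h1 := h.1
      have h2 := diffValue_nonneg (x - 1) (n := n + 1) (by omega)
      have h3 := mul_le_mul_of_nonneg_left (average_le_diffValue x hn) hs.le
      have h4 := mul_nonneg hs.le h2
      linarith
  | cons b l ih =>
    rw [averageLower_cons]
    have e1 : x + 1 - 2 = x - 1 := by ring
    have hb : LowerRow (n + 1) (x - 1) (b :: l) := e1 ▸ h.2
    refine ⟨(hhalf _).trans ?_, ih (x := x - 2) (by rwa [show x - 2 + 1 = x - 1 by ring])⟩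
    have h1 := h.1
    have h2 := hb.1
    have h3 := mul_le_mul_of_nonneg_left (average_le_diffValue x hn) hs.le
    push_cast
    linarith

/-- The neighbour missing at the lower end is replaced by the last entry, by monotonicity in the
difference. `y` is a natural number standing in for `x`; truncated subtraction preserves `x ≤ y`
when the differences turn negative. -/
theorem upperRow_averageUpper {n : ℕ} (hn : 1 ≤ n) (e : Bool) {q : ℕ} (hq : scale ≤ q * n)
    {l : List ℕ} {x : ℤ} {y a : ℕ} (hxy : x ≤ y)
    (h : UpperRow (n + 1) (x + 1) (a :: l)) : UpperRow n x (averageUpper e q l a y) := by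
  have hhalf : ∀ k : ℕ, (k : ℝ) / 2 ≤ (((k + 1) / 2 : ℕ) : ℝ) := fun k => by
    rw [div_le_iff₀ (by norm_num)]
    exact_mod_cast (by omega : k ≤ (k + 1) / 2 * 2)
  have hs : (0 : ℝ) < scale := by norm_num [scale]
  have hn0 : (0 : ℝ) < n := by exact_mod_cast hn
  have hstopping : ∀ {x : ℤ} {y : ℕ}, x ≤ y → scale * ((x : ℝ) / n) ≤ ((y * q : ℕ) : ℝ) := by
    intro x y hxy
    have h1 : (x : ℝ) ≤ y := by exact_mod_cast hxy
    have h2 : (scale : ℝ) ≤ q * n := by exact_mod_cast hq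
    rw [← mul_div_assoc, div_le_iff₀ hn0]
    push_cast
    calc (scale : ℝ) * x ≤ scale * y := by gcongr
      _ ≤ (q * n) * y := by gcongr
      _ = y * q * n := by ring
  have hcell : ∀ {x : ℤ} {y w : ℕ}, x ≤ y →
      scale * ((diffValue (x + 1) (n + 1) + diffValue (x - 1) (n + 1)) / 2) ≤ w →
      scale * diffValue x n ≤ ((max w (y * q) : ℕ) : ℝ) := by
    intro x y w hxy hw
    rw [diffValue_eq_max x hn, mul_max_of_nonneg _ _ hs.le, Nat.cast_max]
    exact max_le ((hstopping hxy).trans (le_max_right _ _)) (hw.trans (le_max_left _ _))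
  induction l generalizing x y a with
  | nil =>
    rw [averageUpper_nil]
    cases e
    · trivial
    · refine ⟨hcell hxy ?_, trivial⟩
      have h1 := h.1
      have h2 := diffValue_mono_left (show x - 1 ≤ x + 1 by omega) (n := n + 1) (by omega)
      have h3 := mul_le_mul_of_nonneg_left h2 hs.le
      linarith
  | cons b l ih =>
    rw [averageUpper_cons]
    have e1 : x + 1 - 2 = x - 1 := by ring
    have hb : UpperRow (n + 1) (x - 1) (b :: l) := e1 ▸ h.2
    refine ⟨hcell hxy (le_trans ?_ (hhalf _)),
      ih (x := x - 2) (by omega) (by rwa [show x - 2 + 1 = x - 1 by ring])⟩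
    have h1 := h.1
    have h2 := hb.1
    push_cast
    linarith

/-- The coefficient of the third order expansion of the weight integral, after 2500 flips. -/
def slopeLower (x : ℤ) : ℤ :=
  3 * 2500 ^ 3 - 6 * x * 2500 ^ 2 + 6 * (x ^ 2 + 2500) * 2500 - 4 * (x ^ 3 + 3 * x * 2500)

/-- The coefficient of the fourth order expansion of the weight integral, after 2500 flips. -/
def slopeUpper (x : ℤ) : ℤ :=
  slopeLower x * 2500 + 2 * (x ^ 4 + 6 * x ^ 2 * 2500 + 3 * 2500 ^ 2)

/-- From a lower bound at difference `x` to one at `x - 2`. -/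
def stepLower (x g : ℤ) : ℤ :=
  (slopeLower x * g + (-6 * 2500 ^ 2 + 6 * x * 2500 - 4 * (x ^ 2 + 2 * 2500)) *
    (scale * 2 ^ 20)) / (3 * 2500 ^ 3)

/-- From an upper bound at difference `x` to one at `x - 2`. -/
def stepUpper (x g : ℤ) : ℤ :=
  (slopeUpper x * g + ((-6 * 2500 ^ 2 + 6 * x * 2500 - 4 * (x ^ 2 + 2 * 2500)) * 2500 +
    2 * (x ^ 3 + 5 * x * 2500)) * (scale * 2 ^ 20)) / (3 * 2500 ^ 4) + 1

/-- Lower bounds for the value after 2500 flips, at differences below `x`. -/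
def seedLower : ℕ → ℤ → ℤ → List ℕ
  | 0, _, _ => []
  | k + 1, x, g =>
    bif decide (0 ≤ slopeLower x) then
      -- `0.2943904112` is `0.29452 * (1 - 1.1 / 2500)`; the integrals carry 20 more binary digits
      -- than the rows.
      (stepLower x g * 2943904112 / (10 ^ 10 * 2 ^ 20)).toNat ::
        seedLower k (x - 2) (stepLower x g)
    else []

/-- Upper bounds for the value after 2500 flips, from difference `x` on downwards. -/
def seedUpper : ℕ → ℤ → ℤ → List ℕ
  | 0, _, _ => []
  | k + 1, x, g =>
    (g * 2945344 / (10 ^ 7 * 2 ^ 20) + 1).toNat ::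
      bif decide (0 ≤ slopeUpper x) then seedUpper k (x - 2) (stepUpper x g) else []

theorem ediv_le {a b : ℤ} (hb : 0 < b) : ((a / b : ℤ) : ℝ) ≤ (a : ℝ) / b := by
  rw [le_div_iff₀ (by exact_mod_cast hb)]
  exact_mod_cast Int.ediv_mul_le a hb.ne'

theorem le_ediv_add_one {a b : ℤ} (hb : 0 < b) : (a : ℝ) / b ≤ ((a / b + 1 : ℤ) : ℝ) := by
  rw [div_le_iff₀ (by exact_mod_cast hb)]
  exact_mod_cast (Int.lt_ediv_add_one_mul_self a hb).le

/-- The sign of the slope permits replacing the integral by its bound `g` in the shift inequality;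
floor division then rounds in the safe direction. -/
theorem le_stepLower {x g : ℤ} (hx : 0 ≤ slopeLower x)
    (hg : (g : ℝ) ≤ scale * 2 ^ 20 * gaussMoment 0 x 2500) :
    (stepLower x g : ℝ) ≤ scale * 2 ^ 20 * gaussMoment 0 (x - 2 : ℤ) 2500 := by
  have h1 := gaussMoment_sub_two_ge x (n := 2500) (by norm_num)
  have hs : (0 : ℝ) < scale * 2 ^ 20 := by norm_num [scale]
  have hx' : (0 : ℝ) ≤ slopeLower x := by exact_mod_cast hx
  have h2 := mul_le_mul_of_nonneg_left hg hx'
  unfold stepLower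
  refine (ediv_le (by norm_num)).trans ?_
  rw [div_le_iff₀ (by norm_num)]
  have h3 := mul_le_mul_of_nonneg_left h1 hs.le
  have e : (slopeLower x : ℝ) = 3 * 2500 ^ 3 - 6 * x * 2500 ^ 2 + 6 * (x ^ 2 + 2500) * 2500 -
      4 * (x ^ 3 + 3 * x * 2500) := by
    unfold slopeLower; push_cast; ring
  rw [← e] at h3
  push_cast
  linarith

theorem stepUpper_le {x g : ℤ} (hx : 0 ≤ slopeUpper x)
    (hg : scale * 2 ^ 20 * gaussMoment 0 x 2500 ≤ (g : ℝ)) :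
    scale * 2 ^ 20 * gaussMoment 0 (x - 2 : ℤ) 2500 ≤ (stepUpper x g : ℝ) := by
  have h1 := gaussMoment_sub_two_le x (n := 2500) (by norm_num)
  have hs : (0 : ℝ) < scale * 2 ^ 20 := by norm_num [scale]
  have hx' : (0 : ℝ) ≤ slopeUpper x := by exact_mod_cast hx
  have h2 := mul_le_mul_of_nonneg_left hg hx'
  unfold stepUpper
  refine le_trans ?_ (le_ediv_add_one (by norm_num))
  rw [le_div_iff₀ (by norm_num)]
  have h3 := mul_le_mul_of_nonneg_left h1 hs.le
  have e : (slopeUpper x : ℝ) = 3 * 2500 ^ 4 - 6 * x * 2500 ^ 3 + 6 * (x ^ 2 + 2500) * 2500 ^ 2 -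
      4 * (x ^ 3 + 3 * x * 2500) * 2500 + 2 * (x ^ 4 + 6 * x ^ 2 * 2500 + 3 * 2500 ^ 2) := by
    unfold slopeUpper slopeLower; push_cast; ring
  rw [← e] at h3
  push_cast
  linarith

theorem lowerRow_seedLower (k : ℕ) {x g : ℤ} (hx42 : x ≤ 42)
    (hg : (g : ℝ) ≤ scale * 2 ^ 20 * gaussMoment 0 x 2500) :
    LowerRow 2500 (x - 2) (seedLower k x g) := by
  induction k generalizing x g with
  | zero => trivial
  | succ k ih =>
    unfold seedLower
    by_cases hx : 0 ≤ slopeLower x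
    · rw [decide_eq_true hx, cond_true]
      have h := le_stepLower hx hg
      refine ⟨?_, ih (by omega) h⟩
      set g' := stepLower x g
      -- `lowerValue_le_diffValue` needs a difference strictly below `0.84 * 50 = 42`, so the row
      -- begins at `x - 2`.
      have hv : lowerValue (x - 2 : ℤ) (2500 : ℕ) ≤ diffValue (x - 2) 2500 := by
        refine lowerValue_le_diffValue le_rfl ?_
        have : √((2500 : ℕ) : ℝ) = 50 := by
          rw [Real.sqrt_eq_iff_mul_self_eq] <;> norm_num
        rw [this]
        have : ((x - 2 : ℤ) : ℝ) ≤ 40 := by exact_mod_cast (by omega : x - 2 ≤ 40)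
        linarith
      have hs : (0 : ℝ) < scale := by norm_num [scale]
      have h0 := mul_le_mul_of_nonneg_left hv hs.le
      have h1 : ((g' * 2943904112 / (10 ^ 10 * 2 ^ 20) : ℤ) : ℝ) ≤
          scale * diffValue (x - 2) 2500 := by
        refine (ediv_le (by norm_num)).trans (le_trans ?_ h0)
        rw [div_le_iff₀ (by norm_num)]
        unfold lowerValue
        push_cast at h ⊢
        linarith
      have h2 := mul_nonneg hs.le (diffValue_nonneg (x - 2) (n := 2500) (by norm_num))
      rcases le_total 0 (g' * 2943904112 / (10 ^ 10 * 2 ^ 20)) with h3 | h3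
      · have : (((g' * 2943904112 / (10 ^ 10 * 2 ^ 20)).toNat : ℤ) : ℝ) ≤
            scale * diffValue (x - 2) 2500 := by rwa [Int.toNat_of_nonneg h3]
        exact_mod_cast this
      · rw [Int.toNat_of_nonpos h3]
        simpa using h2
    · rw [decide_eq_false hx, cond_false]
      trivial

theorem upperRow_seedUpper (k : ℕ) {x g : ℤ}
    (hg : scale * 2 ^ 20 * gaussMoment 0 x 2500 ≤ (g : ℝ)) :
    UpperRow 2500 x (seedUpper k x g) := by
  induction k generalizing x g with
  | zero => trivial
  | succ k ih =>
    unfold seedUpper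
    refine ⟨?_, ?_⟩
    · have hv := diffValue_le_gaussMoment x (n := 2500) (by norm_num)
      have hs : (0 : ℝ) < scale := by norm_num [scale]
      have h0 := mul_le_mul_of_nonneg_left hv hs.le
      have h1 : scale * diffValue x 2500 ≤
          ((g * 2945344 / (10 ^ 7 * 2 ^ 20) + 1 : ℤ) : ℝ) := by
        refine h0.trans (le_trans ?_ (le_ediv_add_one (by norm_num)))
        rw [le_div_iff₀ (by norm_num)]
        push_cast
        linarith
      refine h1.trans ?_
      exact_mod_cast Int.self_le_toNat _
    · by_cases hx : 0 ≤ slopeUpper x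
      · rw [decide_eq_true hx, cond_true]
        exact ih (stepUpper_le hx hg)
      · rw [decide_eq_false hx, cond_false]
        trivial

/-! ### Backward induction from 2500 flips to the opening. -/

/-- The table does not continue after `n` flips at a difference larger than `t`. -/
def checkLower (n t : ℕ) : Bool :=
  Nat.ble 26 t || openingTable.all fun r =>
    Nat.blt n (r.2.2.1 + r.2.2.2) || Nat.ble r.1 t || Nat.beq ((r.1 + n) % 2) 1

/-- The table does not stop after `n` flips at a difference of at most `t`. -/
def checkUpper (n t : ℕ) : Bool :=
  Nat.blt 1000 n || (Nat.ble t 26 && openingTable.all fun r =>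
    Nat.blt (r.2.1.1 + r.2.1.2) n || Nat.blt t r.1 || Nat.beq ((r.1 + n) % 2) 1)

/-- Backward induction for lower bounds; `t` is the largest difference at which one goes on. -/
noncomputable def runLower : ℕ → ℕ → List ℕ → Bool
  | 0, _, _ => true
  | _ + 1, _, [] => false
  | j + 1, t, u :: r =>
    bif Nat.blt (2 * scale * (t + 1)) (((t + 2) * (scale / (j + 4)) + u) * (j + 3)) then
      force (t + 1) fun t' => checkLower (j + 3) t' &&
        runLower j t' (averageLower false (u :: r) ((t' + 1) * (scale / (j + 4))))
    else
      Nat.ble 1 t && force (t - 1) fun t' =>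
        Nat.blt (scale * t') ((averageLower true r u).headD 0 * (j + 3)) &&
          checkLower (j + 3) t' && runLower j t' (averageLower true r u)

/-- Backward induction for upper bounds; one stops at all differences larger than `t`. -/
noncomputable def runUpper : ℕ → ℕ → List ℕ → Bool
  | 0, _, _ => true
  | _ + 1, _, [] => false
  | j + 1, t, u :: r =>
    bif Nat.ble (((t + 2) * (scale / (j + 3) + 1) + u) * (j + 2)) (2 * scale * (t + 1)) then
      Nat.ble 1 t && force (t - 1) fun t' => force (scale / (j + 2) + 1) fun q =>
        checkUpper (j + 2) t' && runUpper j t' (averageUpper true q r u t')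
    else
      force (t + 1) fun t' => force (scale / (j + 2) + 1) fun q =>
        checkUpper (j + 2) t' && runUpper j t'
          (averageUpper false q (u :: r) ((t' + 1) * (scale / (j + 3) + 1)) t')

/-- `285201 / 5000000` is `2.85201 / 50`, a lower bound for the integral at difference `42`. The 96
entries reach from `40` down to `-150`, three standard deviations of 2500 flips. -/
theorem runLower_seed :
    runLower 2497 40 (seedLower 96 42 (285201 * (scale * 2 ^ 20) / 5000000)) = true := by
  decide +kernel

theorem scale_pos : (0 : ℝ) < scale := by norm_num [scale]

theorem mul_div_scale_le (t : ℕ) {n : ℕ} (hn : 1 ≤ n) :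
    ((t * (scale / n) : ℕ) : ℝ) ≤ scale * diffValue t n := by
  have h := div_le_diffValue (t : ℤ) hn
  have h1 : ((scale / n : ℕ) : ℝ) ≤ (scale : ℝ) / n := Nat.cast_div_le
  calc ((t * (scale / n) : ℕ) : ℝ) = t * ((scale / n : ℕ) : ℝ) := by push_cast; ring
    _ ≤ t * ((scale : ℝ) / n) := by gcongr
    _ = scale * (((t : ℤ) : ℝ) / n) := by push_cast; ring
    _ ≤ _ := mul_le_mul_of_nonneg_left h scale_pos.le

theorem scale_le_succ_div_mul {n : ℕ} (hn : 1 ≤ n) : scale ≤ (scale / n + 1) * n := by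
  have := Nat.lt_div_mul_add (a := scale) (b := n) hn
  rw [add_mul, one_mul]
  exact this.le

theorem le_mul_succ_div_scale (t : ℕ) {n : ℕ} (hn : 1 ≤ n)
    (h : diffValue t n ≤ (t : ℝ) / n) :
    scale * diffValue t n ≤ ((t * (scale / n + 1) : ℕ) : ℝ) := by
  have hn' : (0 : ℝ) < n := by exact_mod_cast hn
  have h1 : (scale : ℝ) ≤ ((scale / n + 1 : ℕ) : ℝ) * n := by
    exact_mod_cast scale_le_succ_div_mul hn
  have h2 : (scale : ℝ) / n ≤ ((scale / n + 1 : ℕ) : ℝ) := by rwa [div_le_iff₀ hn']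
  calc scale * diffValue t n ≤ scale * ((t : ℝ) / n) := mul_le_mul_of_nonneg_left h scale_pos.le
    _ = t * ((scale : ℝ) / n) := by ring
    _ ≤ t * ((scale / n + 1 : ℕ) : ℝ) := by gcongr
    _ = _ := by push_cast; ring

/-- The row bounds the values at `t`, `t - 2`, ..., and at `t + 2` the payoff itself is a lower
bound. One flip earlier the threshold becomes `t + 1` if these two bounds prove continuing there;
otherwise `t - 1` is tested. -/
theorem runLower_sound {j t : ℕ} {l : List ℕ} (hl : LowerRow (j + 3) t l)
    (h : runLower j t l = true) {n : ℕ} (hn : 3 ≤ n) (hnj : n < j + 3) :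
    ∃ t' : ℕ, (t' : ℝ) / n < diffValue t' n ∧ checkLower n t' = true := by
  induction j generalizing t l with
  | zero => omega
  | succ j ih =>
    have hs := scale_pos
    cases l with
    | nil => simp [runLower] at h
    | cons u r =>
      rw [runLower] at h
      have hj : (0 : ℝ) < (j + 3 : ℕ) := by positivity
      cases hc : Nat.blt (2 * scale * (t + 1)) (((t + 2) * (scale / (j + 4)) + u) * (j + 3)) with
      | true =>
        rw [hc, cond_true, force_eq, Bool.and_eq_true] at h
        have hS := mul_div_scale_le (t + 2) (n := j + 4) (by omega)
        have hu := hl.1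
        by_cases hnj' : n < j + 3
        · refine ih (t := t + 1) (lowerRow_averageLower (by omega) false ?_) h.2 hnj'
          refine ⟨?_, ?_⟩
          · convert hS using 3; push_cast; ring
          · convert hl using 1; push_cast; ring
        · obtain rfl : n = j + 3 := by omega
          refine ⟨t + 1, ?_, h.1⟩
          have ha := average_le_diffValue ((t + 1 : ℕ) : ℤ) (n := j + 3) (by omega)
          have e1 : ((t + 1 : ℕ) : ℤ) + 1 = ((t + 2 : ℕ) : ℤ) := by push_cast; ring
          have e2 : ((t + 1 : ℕ) : ℤ) - 1 = t := by push_cast; ring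
          rw [e1, e2] at ha
          have hc' : 2 * scale * (t + 1) < ((t + 2) * (scale / (j + 4)) + u) * (j + 3) := by
            simpa [Nat.blt] using hc
          have hc'' : (2 : ℝ) * scale * (t + 1 : ℕ) <
              (((t + 2) * (scale / (j + 4)) : ℕ) + u) * (j + 3 : ℕ) := by exact_mod_cast hc'
          rw [div_lt_iff₀ hj]
          have h5 : (((t + 2) * (scale / (j + 4)) : ℕ) + (u : ℝ)) ≤
              2 * scale * diffValue (t + 1 : ℕ) (j + 3) := by
            have := mul_le_mul_of_nonneg_left ha hs.le
            have hu' : (u : ℝ) ≤ scale * diffValue t (j + 3 + 1) := hu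
            have hS' : (((t + 2) * (scale / (j + 4)) : ℕ) : ℝ) ≤
              scale * diffValue (t + 2 : ℕ) (j + 3 + 1) := hS
            linarith
          have h6 := mul_le_mul_of_nonneg_right h5 hj.le
          have h7 := hc''.trans_le h6
          nlinarith
      | false =>
        rw [hc, cond_false, force_eq, Bool.and_eq_true, Bool.and_eq_true, Bool.and_eq_true] at h
        obtain ⟨h1, ⟨h2, h3⟩, h4⟩ := h
        have ht : 1 ≤ t := by simpa using h1
        have hrow : LowerRow (j + 3) ((t - 1 : ℕ) : ℤ) (averageLower true r u) := by
          refine lowerRow_averageLower (by omega) true ?_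
          convert hl using 1
          omega
        by_cases hnj' : n < j + 3
        · exact ih hrow h4 hnj'
        · obtain rfl : n = j + 3 := by omega
          refine ⟨t - 1, ?_, h3⟩
          have h2' : scale * (t - 1) < (averageLower true r u).headD 0 * (j + 3) := by
            simpa [Nat.blt] using h2
          have h2'' : (scale : ℝ) * (t - 1 : ℕ) <
              ((averageLower true r u).headD 0 : ℕ) * (j + 3 : ℕ) := by exact_mod_cast h2'
          have h5 : (((averageLower true r u).headD 0 : ℕ) : ℝ) ≤
              scale * diffValue (t - 1 : ℕ) (j + 3) := by
            cases hA : averageLower true r u with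
            | nil =>
              simpa using mul_nonneg hs.le (diffValue_nonneg (t - 1 : ℕ) (n := j + 3) (by omega))
            | cons b A => rw [hA] at hrow; exact hrow.1
          rw [div_lt_iff₀ hj]
          have h6 := mul_le_mul_of_nonneg_right h5 hj.le
          nlinarith

/-- From `t + 2` on the value is exactly the payoff, so the row starts at `t`. One flip earlier,
stopping at `t + 1` is certified if the average of the bounds at `t + 2` and `t` stays below the
payoff. -/
theorem runUpper_sound {j t : ℕ} {l : List ℕ} (hl : UpperRow (j + 2) t l)
    (hstopping : diffValue (t + 2 : ℕ) (j + 2) ≤ ((t + 2 : ℕ) : ℝ) / (j + 2 : ℕ))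
    (hpar : (t + (j + 2)) % 2 = 0)
    (h : runUpper j t l = true) {n : ℕ} (hn : 2 ≤ n) (hnj : n < j + 2) :
    ∃ t' : ℕ, diffValue (t' + 2 : ℕ) n ≤ ((t' + 2 : ℕ) : ℝ) / n ∧ (t' + n) % 2 = 0 ∧
      checkUpper n t' = true := by
  induction j generalizing t l with
  | zero => omega
  | succ j ih =>
    have hs := scale_pos
    cases l with
    | nil => simp [runUpper] at h
    | cons u r =>
      rw [runUpper] at h
      have hj : (0 : ℝ) < (j + 2 : ℕ) := by positivity
      have hS := le_mul_succ_div_scale (t + 2) (n := j + 3) (by omega) hstopping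
      have hq := scale_le_succ_div_mul (n := j + 2) (by omega)
      cases hc : Nat.ble (((t + 2) * (scale / (j + 3) + 1) + u) * (j + 2))
        (2 * scale * (t + 1)) with
      | true =>
        rw [hc, cond_true, force_eq, force_eq, Bool.and_eq_true, Bool.and_eq_true] at h
        obtain ⟨h1, h2, h3⟩ := h
        have ht : 1 ≤ t := by simpa using h1
        have hst : diffValue (t - 1 + 2 : ℕ) (j + 2) ≤ ((t - 1 + 2 : ℕ) : ℝ) / (j + 2 : ℕ) := by
          have e : t - 1 + 2 = t + 1 := by omega
          rw [e, diffValue_eq_max _ (by omega)]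
          refine max_le (le_of_eq (by push_cast; ring)) ?_
          have e1 : ((t + 1 : ℕ) : ℤ) + 1 = ((t + 2 : ℕ) : ℤ) := by push_cast; ring
          have e2 : ((t + 1 : ℕ) : ℤ) - 1 = t := by push_cast; ring
          rw [e1, e2]
          have hu : scale * diffValue t (j + 2 + 1) ≤ u := hl.1
          have hS' : scale * diffValue (t + 2 : ℕ) (j + 2 + 1) ≤
            (((t + 2) * (scale / (j + 3) + 1) : ℕ) : ℝ) := hS
          have hc' : ((t + 2) * (scale / (j + 3) + 1) + u) * (j + 2) ≤ 2 * scale * (t + 1) := by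
            simpa using hc
          have hc'' : (((t + 2) * (scale / (j + 3) + 1) : ℕ) + (u : ℝ)) * (j + 2 : ℕ) ≤
              2 * scale * (t + 1 : ℕ) := by exact_mod_cast hc'
          rw [le_div_iff₀ hj]
          have h5 := (mul_le_mul_of_nonneg_right (add_le_add hS' hu) hj.le).trans hc''
          rw [← mul_add, mul_assoc] at h5
          refine le_of_mul_le_mul_left (a := (2 : ℝ) * scale) ?_ (by positivity)
          refine le_trans (le_of_eq ?_) h5
          ring
        by_cases hnj' : n < j + 2
        · refine ih (t := t - 1) (upperRow_averageUpper (by omega) true hq le_rfl ?_) hst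
            (by omega) h3 hnj'
          convert hl using 1
          omega
        · obtain rfl : n = j + 2 := by omega
          exact ⟨t - 1, hst, by omega, h2⟩
      | false =>
        rw [hc, cond_false, force_eq, force_eq, Bool.and_eq_true] at h
        -- Stopping at `t + 3` needs no test: both successors stop, and their payoffs average to `(t
        -- + 3) / (j + 3)`, less than `(t + 3) / (j + 2)`.
        have hst : diffValue (t + 1 + 2 : ℕ) (j + 2) ≤ ((t + 1 + 2 : ℕ) : ℝ) / (j + 2 : ℕ) := by
          have h4 := diffValue_eq_of_le (x := (t + 2 : ℕ)) (y := (t + 4 : ℕ)) (n := j + 3)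
            (by push_cast; omega) (by omega) hstopping
          rw [diffValue_eq_max _ (by omega)]
          refine max_le (le_of_eq (by push_cast; ring)) ?_
          have e1 : ((t + 1 + 2 : ℕ) : ℤ) + 1 = ((t + 4 : ℕ) : ℤ) := by push_cast; ring
          have e2 : ((t + 1 + 2 : ℕ) : ℤ) - 1 = (t + 2 : ℕ) := by push_cast; ring
          rw [e1, e2]
          have h4' : diffValue (t + 4 : ℕ) (j + 2 + 1) ≤ ((t + 4 : ℕ) : ℝ) / (j + 3 : ℕ) := h4
          have h2' : diffValue (t + 2 : ℕ) (j + 2 + 1) ≤ ((t + 2 : ℕ) : ℝ) / (j + 3 : ℕ) := hstopping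
          have h7 : ((t + 3 : ℕ) : ℝ) / (j + 3 : ℕ) ≤ ((t + 3 : ℕ) : ℝ) / (j + 2 : ℕ) := by
            gcongr; omega
          have h8 : ((t + 4 : ℕ) : ℝ) / (j + 3 : ℕ) + ((t + 2 : ℕ) : ℝ) / (j + 3 : ℕ) =
            2 * (((t + 3 : ℕ) : ℝ) / (j + 3 : ℕ)) := by push_cast; ring
          have e3 : t + 1 + 2 = t + 3 := by omega
          rw [e3]
          linarith
        by_cases hnj' : n < j + 2
        · refine ih (t := t + 1) (upperRow_averageUpper (by omega) false hq le_rfl ?_) hst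
            (by omega) h.2 hnj'
          refine ⟨?_, ?_⟩
          · convert hS using 3; push_cast; ring
          · convert hl using 1; push_cast; ring
        · obtain rfl : n = j + 2 := by omega
          exact ⟨t + 1, hst, by omega, h.1⟩

/-- The upper bounds after 2499 flips. -/
noncomputable def startUpper : List ℕ → List ℕ
  | [] => []
  | u :: r => averageUpper true (scale / 2499 + 1) r u 41

theorem runUpper_start :
    runUpper 2497 41
      (startUpper (seedUpper 97 42 (285203 * (scale * 2 ^ 20) / 5000000 + 1))) = true := by
  decide +kernel

theorem gaussMoment_start : gaussMoment 0 42 2500 = gaussMoment 0 0.84 1 / 50 := by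
  have h := gaussMoment_zero_mul (s := 50) (by norm_num) 0.84
  norm_num at h ⊢
  exact h

/-- After 2500 flips the Gaussian bound lies slightly above the payoff and certifies no stop. One
flip earlier there is room: the average over `42` and `44` is at most the value at `42` plus `1 /
2500`. -/
theorem diffValue_start : diffValue 43 2499 ≤ 43 / 2499 := by
  have h1 := diffValue_le_gaussMoment 42 (n := 2500) (by norm_num)
  have h2 := diffValue_add_le (x := 42) (y := 44) (by norm_num) (n := 2500) (by norm_num)
  have h3 := gaussMoment_bounds.2
  have h4 := gaussMoment_start
  norm_num at h1 h2 h3 h4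
  rw [h4] at h1
  rw [diffValue_eq_max _ (by norm_num)]
  norm_num
  linarith

theorem exists_stop {n : ℕ} (hn : 2 ≤ n) (hn' : n ≤ 1000) :
    ∃ t : ℕ, diffValue (t + 2 : ℕ) n ≤ ((t + 2 : ℕ) : ℝ) / n ∧ (t + n) % 2 = 0 ∧
      checkUpper n t = true := by
  refine runUpper_sound (j := 2497) (t := 41) ?_ ?_ (by norm_num) runUpper_start hn (by omega)
  · have hg : scale * 2 ^ 20 * gaussMoment 0 (42 : ℤ) 2500 ≤
        ((285203 * (scale * 2 ^ 20) / 5000000 + 1 : ℤ) : ℝ) := by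
      refine le_trans ?_ (le_ediv_add_one (by norm_num))
      have h3 := gaussMoment_bounds.2
      have h4 := gaussMoment_start
      push_cast
      rw [h4]
      have := mul_le_mul_of_nonneg_left h3.le scale_pos.le
      linarith
    have := upperRow_seedUpper 97 hg
    cases hl : seedUpper 97 42 (285203 * (scale * 2 ^ 20) / 5000000 + 1) with
    | nil => trivial
    | cons u r =>
      rw [hl] at this
      exact upperRow_averageUpper (by norm_num) true (scale_le_succ_div_mul (by norm_num))
        (by norm_num) (by simpa using this)
  · have := diffValue_start
    norm_num at this ⊢
    exact this

theorem exists_go {n : ℕ} (hn : 3 ≤ n) (hn' : n < 2500) :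
    ∃ t : ℕ, (t : ℝ) / n < diffValue t n ∧ checkLower n t = true := by
  refine runLower_sound (j := 2497) (t := 40) ?_ runLower_seed hn (by omega)
  have hg : ((285201 * (scale * 2 ^ 20) / 5000000 : ℤ) : ℝ) ≤
      scale * 2 ^ 20 * gaussMoment 0 (42 : ℤ) 2500 := by
    refine (ediv_le (by norm_num)).trans ?_
    have h3 := gaussMoment_bounds.1
    have h4 := gaussMoment_start
    push_cast
    rw [h4]
    have := mul_le_mul_of_nonneg_left h3.le scale_pos.le
    linarith
  simpa using lowerRow_seedLower 96 le_rfl hg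

/-! ### Reading off the table. -/

theorem le_26_of_mem {d hs ts hg tg : ℕ} (h : (d, (hs, ts), (hg, tg)) ∈ openingTable) :
    1 ≤ d ∧ d ≤ 26 ∧ hs = ts + d ∧ hg = tg + d ∧ hs + ts ≤ 990 := by
  have : ∀ r ∈ openingTable, 1 ≤ r.1 ∧ r.1 ≤ 26 ∧ r.2.1.1 = r.2.1.2 + r.1 ∧
      r.2.2.1 = r.2.2.2 + r.1 ∧ r.2.1.1 + r.2.1.2 ≤ 990 := by decide
  exact this _ h

theorem diffValue_one_one : diffValue 1 1 ≤ 1 :=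
  ciSup_le fun k => (horizonValue_le_max k 1 le_rfl).trans (by norm_num)

theorem stoppingOptimal_of_tableStop {a n : ℕ} (han : a ≤ n) (h : TableStop a n) :
    StoppingOptimal a n := by
  have hd : 1 ≤ 2 * (a : ℤ) - n ∧ n ≤ 1000 := by
    rcases h with h | ⟨d, hs, ts, hg, tg, hm, h1, h2⟩
    · omega
    · have := le_26_of_mem hm
      omega
  have hn : 1 ≤ n := by omega
  refine stoppingOptimal_of_diffValue_le han hn ?_
  -- A single flip lies outside `exists_stop`; there the payoff `1` cannot be improved.
  rcases hn.eq_or_lt with rfl | hn2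
  · obtain rfl : a = 1 := by omega
    simpa using diffValue_one_one
  · obtain ⟨t, ht, hp, hc⟩ := exists_stop hn2 hd.2
    -- `t` has the parity of `n`, so a difference above `t` is at least `t + 2`.
    refine diffValue_eq_of_le (x := (t + 2 : ℕ)) ?_ hn (by rwa [Int.cast_natCast])
    rw [checkUpper, Bool.or_eq_true, Bool.and_eq_true, List.all_eq_true] at hc
    rcases hc with hc | ⟨hc1, hc2⟩
    · have : 1001 ≤ n := by simpa [Nat.blt] using hc
      omega
    · have ht26 : t ≤ 26 := by simpa using hc1
      rcases h with h | ⟨d, hs, ts, hg, tg, hm, h1, h2⟩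
      · push_cast; omega
      · have := hc2 _ hm
        simp only [Nat.blt, Nat.ble_eq, Nat.beq_eq, Bool.or_eq_true] at this
        push_cast; omega

theorem continuingBetter_of_tableGo {a n : ℕ} (han : a ≤ n) (h : TableGo a n) :
    ContinuingBetter a n := by
  rcases h with h | ⟨d, hs, ts, hg, tg, hm, h1, h2⟩
  · exact continuingBetter_of_nonpos han h
  · have hd := le_26_of_mem hm
    have h3 : 3 ≤ n := by
      by_contra hn
      have : ∀ r ∈ openingTable, 3 ≤ r.2.2.1 + r.2.2.2 := by decide
      have := this _ hm
      simp only at this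
      omega
    refine continuingBetter_of_lt_diffValue han (by omega) ?_
    -- The table's claim to continue has no upper limit on `n`; beyond the computation the analytic
    -- bound takes over.
    rcases le_or_gt 2500 n with hn | hn
    · exact div_lt_diffValue_of_le_26 (by omega) hn
    · obtain ⟨t, ht, hc⟩ := exists_go h3 hn
      refine div_lt_diffValue_of_le (y := t) ?_ (by omega) (by rwa [Int.cast_natCast])
      rw [checkLower, Bool.or_eq_true, List.all_eq_true] at hc
      rcases hc with hc | hc
      · have : 26 ≤ t := by simpa using hc
        omega
      · have := hc _ hm
        simp only [Nat.blt, Nat.ble_eq, Nat.beq_eq, Bool.or_eq_true] at this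
        omega

theorem tableStop_iff {d t : ℕ} (hd : d ≤ 26) :
    TableStop (t + d) (2 * t + d) ↔ ∃ r ∈ openingTable, d = r.1 ∧ 2 * t + d ≤ r.2.1.1 + r.2.1.2 := by
  constructor
  · rintro (h | ⟨d', hs, ts, hg, tg, hm, h1, h2⟩)
    · omega
    · exact ⟨_, hm, by push_cast at h1; omega, h2⟩
  · rintro ⟨r, hm, h1, h2⟩
    exact .inr ⟨_, _, _, _, _, hm, by push_cast; omega, h2⟩

theorem tableGo_iff {d t : ℕ} (hd : 1 ≤ d) :
    TableGo (t + d) (2 * t + d) ↔ ∃ r ∈ openingTable, d = r.1 ∧ r.2.2.1 + r.2.2.2 ≤ 2 * t + d := by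
  constructor
  · rintro (h | ⟨d', hs, ts, hg, tg, hm, h1, h2⟩)
    · omega
    · exact ⟨_, hm, by push_cast at h1; omega, h2⟩
  · rintro ⟨r, hm, h1, h2⟩
    exact .inr ⟨_, _, _, _, _, hm, by push_cast; omega, h2⟩

set_option maxHeartbeats 4000000 in
theorem undecided_iff {a n : ℕ} (han : a ≤ n) (hn : n ≤ 1000) :
    ¬ (TableStop a n ∨ TableGo a n) ↔ (a, n - a) ∈ openPositions := by
  have hopen : ∀ p ∈ openPositions, p.2 < p.1 ∧ p.1 < p.2 + 27 := by decide
  by_cases h0 : 2 * (a : ℤ) - n ≤ 0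
  · refine iff_of_false (fun h => h (.inr (.inl h0))) fun h => ?_
    have := hopen _ h
    simp only at this
    omega
  by_cases h1 : 27 ≤ 2 * (a : ℤ) - n
  · refine iff_of_false (fun h => h (.inl (.inl ⟨h1, hn⟩))) fun h => ?_
    have := hopen _ h
    simp only at this
    omega
  -- `t` counts the tails and `d` is the difference. For fixed `d` the undecided positions are those
  -- between the two table entries: one if the entries are two heads apart, none otherwise.
  obtain ⟨t, rfl⟩ := Nat.exists_eq_add_of_le han
  obtain ⟨d, rfl⟩ := Nat.exists_eq_add_of_le (show t ≤ a by omega)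
  have e : t + d + t = 2 * t + d := by ring
  rw [Nat.add_sub_cancel_left, e, tableStop_iff (by omega), tableGo_iff (by omega)]
  have hd1 : 1 ≤ d := by omega
  have hd2 : d ≤ 26 := by omega
  clear h0 h1 hopen e
  interval_cases d <;> simp [openingTable, openPositions] <;> omega

end ChowRobbins

theorem mainTheorem2 :
    -- with 5 heads and 3 tails, stopping is optimal
    ChowRobbins.V 5 8 = 5 / 8 ∧
    -- the decisions given by the table are the optimal ones
    (∀ a n : ℕ, a ≤ n → ChowRobbins.TableStop a n → ChowRobbins.StoppingOptimal a n) ∧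
    (∀ a n : ℕ, a ≤ n → ChowRobbins.TableGo a n → ChowRobbins.ContinuingBetter a n) ∧
    -- with at most 1000 flips the table decides all positions except the seven open ones
    (∀ a n : ℕ, a ≤ n → n ≤ 1000 →
      (¬ (ChowRobbins.TableStop a n ∨ ChowRobbins.TableGo a n) ↔
        (a, n - a) ∈ ChowRobbins.openPositions)) := by
  refine ⟨?_, fun a n han h => ChowRobbins.stoppingOptimal_of_tableStop han h,
    fun a n han h => ChowRobbins.continuingBetter_of_tableGo han h,
    fun a n han hn => ChowRobbins.undecided_iff han hn⟩
  have h : ChowRobbins.StoppingOptimal 5 8 := by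
    refine ChowRobbins.stoppingOptimal_of_tableStop (by norm_num)
      (.inr ⟨2, 5, 3, 6, 4, by simp [ChowRobbins.openingTable], by norm_num, by norm_num⟩)
  unfold ChowRobbins.StoppingOptimal at h
  exact_mod_cast h
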